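/- Throughout, manifolds are smooth, separable and metrizable, with possibly empty boundary, and not necessarily connected; $m\ge 1$, $Q=(-1,1)$ and $\mathbb H^m=[0,\infty)\times\mathbb R^{m-1}$. **Uniform regularity.** Let $(M,g)$ be an $m$-dimensional Riemannian manifold. A local chart $\kappa\colon U_\kappa\to\mathbb R^m$ of $M$ is *normalized* if $\kappa(U_\kappa)=Q^m$ when $U_\kappa$ is contained in the interior of $M$, and $\kappa(U_\kappa)=Q^m\cap\mathbb H^m$ when $U_\kappa\cap\partial M\ne\emptyset$; put $Q_\kappa=\kappa(U_\kappa)$. An atlas $\mathfrak K$ of $M$ is *uniformly regular* if it consists of normalized charts and 1. there is $r\in(0,1)$ such that the sets $\kappa^{-1}(rQ_\kappa)$, $\kappa\in\mathfrak K$, cover $M$; 2. there is $N\in\mathbb N$ such that any intersection of more than $N$ of the domains $U_\kappa$ is empty; 3. for every $k\in\mathbb N$ there is $c(k)$ such that, for all $\kappa,\tilde\kappa\in\mathfrak K$, all derivatives of order at most $k$ of $\tilde\kappa\circ\kappa^{-1}$ are bounded by $c(k)$ on $\kappa(U_\kappa\cap U_{\tilde\kappa})$. $(M,g)$ is *uniformly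 regular* if it has a uniformly regular atlas $\mathfrak K$ such that, for some $c\ge1$, $|\xi|^2/c\le \kappa_*g(x)(\xi,\xi)\le c|\xi|^2$ for all $\kappa\in\mathfrak K$, $x\in Q_\kappa$, $\xi\in\mathbb R^m$, and such that for every $k\in\mathbb N$ all derivatives of order at most $k$ of $\kappa_*g$ are bounded on $Q_\kappa$ by a constant $c(k)$ independent of $\kappa\in\mathfrak K$. **Tame ends.** Let $d\ge m-1$, let $B\subset\mathbb R^d$ be an $(m-1)$-dimensional submanifold (possibly with boundary) and $0\le\alpha\le1$. The *infinite model $\alpha$-funnel over $B$* is $$F_\alpha(B)=\{(t,t^\alpha y) : t>1,\ y\in B\}\subset\mathbb R\times\mathbb R^d=\mathbb R^{1+d},$$ an $m$-dimensional submanifold of $\mathbb R^{1+d}$, endowed with the metric induced by the Euclidean metric of $\mathbb R^{1+d}$. An open set $V\subset M$ is a *tame end* of $(M,g)$ if $(V,g)$ is isometric to $F_\alpha(B)$ for some such $d$ and $\alpha$ and some compact such $B$. We say that $(M,g)$ *has (finitely many) tame ends* if there is a finite open covering $\{V_0,V_1,\dots,V_k\}$ of $M$, $k\ge0$, such that $V_i\cap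 V_j=\emptyset$ for $1\le i<j\le k$, the sets $V_0,V_0\cap V_1,\dots,V_0\cap V_k$ are relatively compact in $M$, and, for $1\le i\le k$, $V_i$ is a tame end by means of an isometry $\Phi_i$ onto a model funnel such that, for some $T>1$, the preimage under $\Phi_i$ of the part $1<t\le T$ of the funnel is relatively compact in $M$ (that is, the end is attached to $M$ along its base). **Theorem.** If an $m$-dimensional Riemannian manifold $(M,g)$, possibly with boundary, has finitely many tame ends, then $(M,g)$ is uniformly regular. -/

import Mathlib

open Set
open scoped Manifold ContDiff

noncomputable section

namespace TameEnds

/-- A smooth Riemannian metric on an `m`-dimensional smooth manifold with (possibly empty)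
boundary. -/
abbrev Metric (m : ℕ) [NeZero m] (M : Type*) [TopologicalSpace M]
    [ChartedSpace (EuclideanHalfSpace m) M] [IsManifold (𝓡∂ m) ∞ M] :=
  Bundle.ContMDiffRiemannianMetric (𝓡∂ m) ∞ (EuclideanSpace ℝ (Fin m))
    (fun p : M => TangentSpace (𝓡∂ m) p)

/-! ### Normalized charts and uniform regularity -/

/-- The cube `(-r, r)^m`; thus `cube m 1` is `Q^m`, where `Q = (-1, 1)`. -/
def cube (m : ℕ) (r : ℝ) : Set (EuclideanSpace ℝ (Fin m)) :=
  {x | ∀ i, |x i| < r}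

/-- The closed half-space `[0, ∞) × ℝ^(m-1)`. -/
def halfSpace (m : ℕ) [NeZero m] : Set (EuclideanSpace ℝ (Fin m)) :=
  {x | 0 ≤ x 0}

/-- `f`, together with its derivatives of order at most `k`, is bounded by `c` on `s`. The set `s`
is always a relatively open subset of `ℝ^m` or of the closed half-space. -/
def BCNormLE {E F : Type*} [NormedAddCommGroup E] [NormedSpace ℝ E] [NormedAddCommGroup F]
    [NormedSpace ℝ F] (k : ℕ) (f : E → F) (s : Set E) (c : ℝ) : Prop :=
  ∀ j ≤ k, ∀ x ∈ s, ‖iteratedFDerivWithin ℝ j f s x‖ ≤ c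

section

variable {m : ℕ} [NeZero m] {M : Type*} [TopologicalSpace M]
  [ChartedSpace (EuclideanHalfSpace m) M]

/-- A normalized local chart of `M`: a diffeomorphism from an open subset `κ.source` of `M` onto
`Q^m` if `κ.source` lies in the interior of `M`, and onto `Q^m ∩ ℍ^m` if `κ.source` meets the
boundary of `M`. -/
structure IsNormalizedChart (κ : PartialEquiv M (EuclideanSpace ℝ (Fin m))) : Prop where
  isOpen_source : IsOpen κ.source
  contMDiffOn : ContMDiffOn (𝓡∂ m) 𝓘(ℝ, EuclideanSpace ℝ (Fin m)) ∞ κ κ.source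
  contMDiffOn_symm : ContMDiffOn 𝓘(ℝ, EuclideanSpace ℝ (Fin m)) (𝓡∂ m) ∞ κ.symm κ.target
  target_of_interior : κ.source ⊆ (𝓡∂ m).interior M → κ.target = cube m 1
  target_of_boundary : (κ.source ∩ (𝓡∂ m).boundary M).Nonempty →
    κ.target = cube m 1 ∩ halfSpace m

/-- A uniformly regular atlas of `M`. -/
structure IsUniformlyRegularAtlas (K : Set (PartialEquiv M (EuclideanSpace ℝ (Fin m)))) :
    Prop where
  /-- All charts are normalized. -/
  normalized : ∀ κ ∈ K, IsNormalizedChart κ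
  /-- The chart domains cover `M`. -/
  covers : ∀ p : M, ∃ κ ∈ K, p ∈ κ.source
  /-- Uniform shrinkability: the sets `κ⁻¹(r Q_κ)`, for some fixed `r ∈ (0, 1)`, cover `M`. -/
  shrinkable : ∃ r : ℝ, 0 < r ∧ r < 1 ∧ ∀ p : M, ∃ κ ∈ K, p ∈ κ.source ∧ κ p ∈ cube m r
  /-- Finite multiplicity: no point lies in more than `N` chart domains. -/
  multiplicity : ∃ N : ℕ, ∀ p : M, {κ ∈ K | p ∈ κ.source}.encard ≤ N
  /-- All derivatives of all coordinate changes are bounded, uniformly over the atlas. -/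
  transition : ∀ k : ℕ, ∃ c : ℝ, ∀ κ ∈ K, ∀ κ' ∈ K,
    BCNormLE k (κ' ∘ κ.symm) (κ '' (κ.source ∩ κ'.source)) c

variable [IsManifold (𝓡∂ m) ∞ M]

/-- The local representation `κ_* g` of the metric `g` in the chart `κ`: its value at
`x ∈ κ.target` is the bilinear form `(ξ, η) ↦ g(d(κ⁻¹)ξ, d(κ⁻¹)η)`. -/
def pushforwardMetric (g : Metric m M) (κ : PartialEquiv M (EuclideanSpace ℝ (Fin m)))
    (x : EuclideanSpace ℝ (Fin m)) :
    EuclideanSpace ℝ (Fin m) →L[ℝ] EuclideanSpace ℝ (Fin m) →L[ℝ] ℝ :=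
  let D : EuclideanSpace ℝ (Fin m) →L[ℝ] EuclideanSpace ℝ (Fin m) :=
    mfderivWithin 𝓘(ℝ, EuclideanSpace ℝ (Fin m)) (𝓡∂ m) κ.symm κ.target x
  let G : EuclideanSpace ℝ (Fin m) →L[ℝ] EuclideanSpace ℝ (Fin m) →L[ℝ] ℝ :=
    g.inner (κ.symm x)
  G.bilinearComp D D

/-- `(M, g)` is uniformly regular: there is a uniformly regular atlas in whose charts `g` is
equivalent to the Euclidean metric and has bounded derivatives of all orders, uniformly over the
atlas. -/
def IsUniformlyRegular (g : Metric m M) : Prop :=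
  ∃ K : Set (PartialEquiv M (EuclideanSpace ℝ (Fin m))),
    IsUniformlyRegularAtlas K ∧
    (∃ c : ℝ, 1 ≤ c ∧ ∀ κ ∈ K, ∀ x ∈ κ.target, ∀ ξ : EuclideanSpace ℝ (Fin m),
      ‖ξ‖ ^ 2 / c ≤ pushforwardMetric g κ x ξ ξ ∧
        pushforwardMetric g κ x ξ ξ ≤ c * ‖ξ‖ ^ 2) ∧
    (∀ k : ℕ, ∃ c : ℝ, ∀ κ ∈ K, BCNormLE k (pushforwardMetric g κ) κ.target c)

end

/-! ### Funnels and tame ends -/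

/-- `B` is an `n`-dimensional smooth (embedded) submanifold of `ℝ^d` with possibly empty boundary:
locally, after a diffeomorphism `φ` between open subsets of `ℝ^d`, it is a relatively open part of
`ℍ^n × {0}`, where `ℍ^n = [0, ∞) × ℝ^(n-1)` for `n ≥ 1` and `ℍ^0 = {0}`. (Interior points of `B` are
those where `φ` can be chosen with values in `x₀ > 0`.) -/
def IsSubmanifold (n d : ℕ) (B : Set (EuclideanSpace ℝ (Fin d))) : Prop :=
  n ≤ d ∧ ∀ p ∈ B, ∃ φ : OpenPartialHomeomorph (EuclideanSpace ℝ (Fin d))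
      (EuclideanSpace ℝ (Fin d)),
    p ∈ φ.source ∧ ContDiffOn ℝ ∞ φ φ.source ∧ ContDiffOn ℝ ∞ φ.symm φ.target ∧
    φ '' (φ.source ∩ B) =
      φ.target ∩ {x | (∀ i, n ≤ i.val → x i = 0) ∧ (∀ i, i.val = 0 → 0 ≤ x i)}

/-- The infinite model funnel `{(t, t^α y) ; t > 1, y ∈ B}` in `ℝ × ℝ^d` (with the Euclidean
structure). -/
def funnel {d : ℕ} (α : ℝ) (B : Set (EuclideanSpace ℝ (Fin d))) :
    Set (WithLp 2 (ℝ × EuclideanSpace ℝ (Fin d))) :=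
  {z | ∃ t : ℝ, 1 < t ∧ ∃ y ∈ B, z = WithLp.toLp 2 (t, t ^ α • y)}

section

variable {m : ℕ} [NeZero m] {M : Type*} [TopologicalSpace M]
  [ChartedSpace (EuclideanHalfSpace m) M] [IsManifold (𝓡∂ m) ∞ M]

/-- `Φ` is an isometry from `(V, g)` onto the set `F ⊆ ℝ × ℝ^d` (a submanifold), the latter with
the metric induced by the Euclidean metric of `ℝ × ℝ^d`: a diffeomorphism that pulls the induced
metric back to `g`. -/
structure IsIsometryOnto (g : Metric m M) {d : ℕ} (V : Set M)
    (F : Set (WithLp 2 (ℝ × EuclideanSpace ℝ (Fin d))))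
    (Φ : PartialEquiv M (WithLp 2 (ℝ × EuclideanSpace ℝ (Fin d)))) : Prop where
  source_eq : Φ.source = V
  target_eq : Φ.target = F
  contMDiffOn : ContMDiffOn (𝓡∂ m) 𝓘(ℝ, WithLp 2 (ℝ × EuclideanSpace ℝ (Fin d))) ∞ Φ V
  contMDiffOn_symm :
    ContMDiffOn 𝓘(ℝ, WithLp 2 (ℝ × EuclideanSpace ℝ (Fin d))) (𝓡∂ m) ∞ Φ.symm F
  inner_eq : ∀ p ∈ V, ∀ v w : TangentSpace (𝓡∂ m) p,
    @inner ℝ (WithLp 2 (ℝ × EuclideanSpace ℝ (Fin d))) _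
      (mfderiv (𝓡∂ m) 𝓘(ℝ, WithLp 2 (ℝ × EuclideanSpace ℝ (Fin d))) Φ p v)
      (mfderiv (𝓡∂ m) 𝓘(ℝ, WithLp 2 (ℝ × EuclideanSpace ℝ (Fin d))) Φ p w) = g.inner p v w

/-- `Φ` exhibits the open subset `V` of `M` as a tame end: it is an isometry onto an infinite model
`α`-funnel, `0 ≤ α ≤ 1`, over a compact `(m-1)`-dimensional submanifold `B` of `ℝ^d`. -/
structure IsTameEnd (g : Metric m M) (V : Set M) {d : ℕ} (α : ℝ)
    (B : Set (EuclideanSpace ℝ (Fin d)))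
    (Φ : PartialEquiv M (WithLp 2 (ℝ × EuclideanSpace ℝ (Fin d)))) : Prop where
  isOpen : IsOpen V
  nonneg : 0 ≤ α
  le_one : α ≤ 1
  isCompact_base : IsCompact B
  isSubmanifold_base : IsSubmanifold (m - 1) d B
  isometry : IsIsometryOnto g V (funnel α B) Φ

/-- `(M, g)` has (finitely many) tame ends `V i`. The last clause says that every end is attached to
`M` along its base: the part `1 < t ≤ T` of the funnel is relatively compact in `M`. (Without it,
the funnel `{t > 1}` itself, which is incomplete, would qualify.) -/
def HasTameEnds (g : Metric m M) : Prop :=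
  ∃ (k : ℕ) (V₀ : Set M) (V : Fin k → Set M),
    IsOpen V₀ ∧ V₀ ∪ ⋃ i, V i = univ ∧
    (∀ i j, i ≠ j → Disjoint (V i) (V j)) ∧
    IsCompact (closure V₀) ∧ (∀ i, IsCompact (closure (V₀ ∩ V i))) ∧
    ∀ i, ∃ (d : ℕ) (α : ℝ) (B : Set (EuclideanSpace ℝ (Fin d)))
      (Φ : PartialEquiv M (WithLp 2 (ℝ × EuclideanSpace ℝ (Fin d)))),
      IsTameEnd g (V i) α B Φ ∧
      ∃ T : ℝ, 1 < T ∧ IsCompact (closure {p ∈ V i | (Φ p).fst ≤ T})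

end

end TameEnds

end

/-!
Uniform regularity can only fail at infinity: a finite family of charts, each relatively compact in
a larger chart (`IsTight`), satisfies all the estimates by compactness. So it suffices to find
uniformly good charts of the ends `F_α(B)`, away from their bases, and to check that finitely many
further charts, which cover the rest of `M`, are compatible with them.

*Charts of an end.* A chart `φ` of the base gives coordinates `x = (x', t)` on the part of the
funnel over its domain, with parametrization `(t, t ^ α • φ⁻¹(x'))` (`funnelMap`). Near height `t₀`
the directions of the base are stretched by `t₀ ^ α`, so a box of height `ε` and of width
`ε t₀ ^ (-α)` in the directions of the base (`IsFunnelBox`) corresponds to a piece of the funnel of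
size about `ε` in all directions. With `s = (t - t₀) / t₀`, the factor `t ^ α = t₀ ^ α (1 + s) ^ α`
shows that, after rescaling the box to the unit cube, the parametrization is a fixed smooth map
composed with an affine map of slope `O(t₀ ^ (-α))` and then multiplied by `t₀ ^ α`; for `s` this
slope bound is `t₀⁻¹ ≤ t₀ ^ (-α)`, which is where `α ≤ 1` enters, and `0 ≤ α` keeps the slopes
bounded. Hence all its derivatives of positive order are bounded independently of the box
(`exists_bound_rescaled`, `exists_bound_funnelMap_boxMap`), and likewise for its inverse, extended
to an open subset of the ambient space (`exists_bound_boxMap_symm_funnelInv`). Coordinate changes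
are compositions of such maps, also for two different charts of the base, and the metric in such a
chart is the pullback of the Euclidean metric by the parametrization, so that all bounds for them
follow.

*The grid.* The boxes are taken from a grid in which the height is subdivided first and then, for
each height, the other directions. Shrunken boxes still cover the end away from its base
(`exists_mem_gridCharts`), and the multiplicity is at most `4 ^ m` for each of the finitely many
charts of the base (`encard_gridCharts_le`). Open boxes that meet the boundary of the
half-space are centered on it, so the charts are normalized.

*Gluing.* The finitely many remaining charts have relatively compact domains, so it is enough that a
compact subset of `M` meets only finitely many of the charts of an end, that is, that the height `t`
is bounded on it. This is not part of the hypotheses, since a priori an end could return to a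
compact part of `M` at great height; it holds because `t` does not increase distances and the slabs
`a ≤ t ≤ b` are compact (`IsTameEnd.exists_nhds_fst_le`). The charts of different ends have disjoint
domains.
-/

noncomputable section

namespace TameEnds

open Filter Topology

/-! ### Bounds for iterated derivatives -/

section Calculus

variable {E F G : Type*} [NormedAddCommGroup E] [NormedSpace ℝ E] [NormedAddCommGroup F]
  [NormedSpace ℝ F] [NormedAddCommGroup G] [NormedSpace ℝ G]

theorem exists_bound_iteratedFDerivWithin {f : E → F} {S K : Set E} (hS : UniqueDiffOn ℝ S)
    (hf : ContDiffOn ℝ ∞ f S) (hK : IsCompact K) (hKS : K ⊆ S) (k : ℕ) :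
    ∃ c : ℝ, ∀ j ≤ k, ∀ x ∈ K, ‖iteratedFDerivWithin ℝ j f S x‖ ≤ c := by
  have h (j : ℕ) : ∃ c : ℝ, ∀ x ∈ K, ‖iteratedFDerivWithin ℝ j f S x‖ ≤ c :=
    hK.exists_bound_of_continuousOn
      ((hf.continuousOn_iteratedFDerivWithin (mod_cast le_top) hS).mono hKS)
  choose c hc using h
  obtain ⟨C, hC⟩ := ((Finset.range (k + 1)).image c).bddAbove
  exact ⟨C, fun j hj x hx => (hc j x hx).trans
    (hC (Finset.mem_coe.2 (Finset.mem_image_of_mem c (by simp; omega))))⟩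

theorem BCNormLE.congr {k : ℕ} {f g : E → F} {s : Set E} {c : ℝ} (h : BCNormLE k f s c)
    (hfg : EqOn g f s) : BCNormLE k g s c := fun j hj x hx => by
  rw [iteratedFDerivWithin_congr hfg hx]; exact h j hj x hx

theorem BCNormLE.mono {k : ℕ} {f : E → F} {s : Set E} {c c' : ℝ} (h : BCNormLE k f s c)
    (hc : c ≤ c') : BCNormLE k f s c' := fun j hj x hx => (h j hj x hx).trans hc

/-- A smooth function on `S` has bounded derivatives on every relatively open part of `S` that is
contained in a compact subset of `S`. -/
theorem exists_bcNormLE_of_compact {f : E → F} {S K s : Set E} (hS : UniqueDiffOn ℝ S)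
    (hf : ContDiffOn ℝ ∞ f S) (hK : IsCompact K) (hKS : K ⊆ S) (hsK : s ⊆ K)
    (hs : ∃ O, IsOpen O ∧ s = S ∩ O) (k : ℕ) : ∃ c : ℝ, BCNormLE k f s c := by
  obtain ⟨c, hc⟩ := exists_bound_iteratedFDerivWithin hS hf hK hKS k
  obtain ⟨O, hO, rfl⟩ := hs
  refine ⟨c, fun j hj x hx => ?_⟩
  rw [iteratedFDerivWithin_inter_open hO hx.2]
  exact hc j hj x (hsK hx)

theorem bcNormLE_of_iteratedFDeriv {f : E → F} {s : Set E} (hs : UniqueDiffOn ℝ s)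
    (hf : ∀ x ∈ s, ContDiffAt ℝ ∞ f x) {k : ℕ} {c : ℝ}
    (h : ∀ j ≤ k, ∀ x ∈ s, ‖iteratedFDeriv ℝ j f x‖ ≤ c) : BCNormLE k f s c := fun j hj x hx => by
  rw [iteratedFDerivWithin_eq_iteratedFDeriv hs ((hf x hx).of_le (mod_cast le_top)) hx]
  exact h j hj x hx

/-- Pointwise bound for the derivatives of a composition. No bound for `f` itself is needed, only
bounds for its derivatives of positive order. -/
theorem norm_iteratedFDeriv_comp_le_of_contDiffAt {g : F → G} {f : E → F} {x : E} {n : ℕ}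
    (hg : ContDiffAt ℝ ∞ g (f x)) (hf : ContDiffAt ℝ ∞ f x) {C D : ℝ} (hD1 : 1 ≤ D)
    (hC : ∀ i ≤ n, ‖iteratedFDeriv ℝ i g (f x)‖ ≤ C)
    (hD : ∀ i, 1 ≤ i → i ≤ n → ‖iteratedFDeriv ℝ i f x‖ ≤ D) :
    ‖iteratedFDeriv ℝ n (g ∘ f) x‖ ≤ n.factorial * C * D ^ n := by
  have hg' : ContDiffAt ℝ n g (f x) := hg.of_le (mod_cast le_top)
  have hf' : ContDiffAt ℝ n f x := hf.of_le (mod_cast le_top)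
  obtain ⟨u, hu, hfu, hcu⟩ := hg'.contDiffOn' le_rfl (by simp)
  obtain ⟨v, hv, hxv, hcv⟩ := hf'.contDiffOn' le_rfl (by simp)
  simp only [insert_eq_of_mem, mem_univ, univ_inter] at hcu hcv
  have hcont : ContinuousOn f v := hcv.continuousOn
  set w := v ∩ f ⁻¹' u with hw
  have hwo : IsOpen w := hcont.isOpen_inter_preimage hv hu
  have hxw : x ∈ w := ⟨hxv, hfu⟩
  have key := norm_iteratedFDerivWithin_comp_le (𝕜 := ℝ) hcu (hcv.mono inter_subset_left)
    (n := n) le_rfl hu.uniqueDiffOn hwo.uniqueDiffOn (s := w) (x := x) (fun y hy => hy.2) hxw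
    (C := C) (D := D) ?_ ?_
  · rwa [iteratedFDerivWithin_of_isOpen n hwo hxw] at key
  · intro i hi
    rw [iteratedFDerivWithin_of_isOpen i hu hfu]; exact hC i hi
  · intro i h1 hi
    rw [iteratedFDerivWithin_of_isOpen i hwo hxw]
    exact (hD i h1 hi).trans (le_self_pow₀ hD1 (by omega))

/-- The scaling estimate: composing a fixed smooth `Θ` with affine maps of slope at most `A * ρ` and
multiplying the result by `ρ⁻¹` leaves the derivatives of positive order bounded, uniformly in
`ρ ∈ (0, 1]`, on the points that are mapped to a fixed compact set. -/
theorem exists_bound_rescaled {H : Type*} [NormedAddCommGroup H] [NormedSpace ℝ H] {Θ : F → G}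
    {O K : Set F} (hO : IsOpen O) (hΘ : ContDiffOn ℝ ∞ Θ O) (hK : IsCompact K) (hKO : K ⊆ O)
    (A : ℝ) (k : ℕ) :
    ∃ C : ℝ, ∀ (L : H →L[ℝ] F) (ρ : ℝ) (a : F) (b : G), 0 < ρ → ρ ≤ 1 → ‖L‖ ≤ A * ρ →
      ∀ u, a + L u ∈ K → ∀ j, 1 ≤ j → j ≤ k →
        ‖iteratedFDeriv ℝ j (fun u => b + ρ⁻¹ • Θ (a + L u)) u‖ ≤ C := by
  obtain ⟨c, hc⟩ := exists_bound_iteratedFDerivWithin hO.uniqueDiffOn hΘ hK hKO k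
  refine ⟨c * (max A 1) ^ k, fun L ρ a b hρ hρ1 hL u hu j hj1 hjk => ?_⟩
  have hshift : IsOpen {y : F | a + y ∈ O} := hO.preimage (by fun_prop)
  have hΘ' : ContDiffOn ℝ ∞ (fun y => Θ (a + y)) {y : F | a + y ∈ O} :=
    hΘ.comp (by fun_prop) (fun y hy => hy)
  have hpre : IsOpen (L ⁻¹' {y : F | a + y ∈ O}) := hshift.preimage L.continuous
  have huO : u ∈ L ⁻¹' {y : F | a + y ∈ O} := hKO hu
  have hcd : ContDiffOn ℝ ∞ ((fun y => Θ (a + y)) ∘ L) (L ⁻¹' {y : F | a + y ∈ O}) :=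
    hΘ'.comp (by fun_prop) (fun y hy => hy)
  have hcdu : ContDiffAt ℝ ∞ (fun u => Θ (a + L u)) u := hcd.contDiffAt (hpre.mem_nhds huO)
  have h1 : iteratedFDeriv ℝ j (fun u => b + ρ⁻¹ • Θ (a + L u)) u
      = ρ⁻¹ • iteratedFDeriv ℝ j (fun u => Θ (a + L u)) u := by
    obtain ⟨i, rfl⟩ : ∃ i, j = i + 1 := ⟨j - 1, by omega⟩
    rw [← iteratedFDeriv_const_smul_apply' (hcdu.of_le (mod_cast le_top))]
    ext v
    simp only [iteratedFDeriv_succ_apply_right]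
    congr 3
    ext y : 1
    exact fderiv_const_add (f := fun u => ρ⁻¹ • Θ (a + L u)) b
  have h2 : iteratedFDeriv ℝ j (fun u => Θ (a + L u)) u
      = (iteratedFDerivWithin ℝ j Θ O (a + L u)).compContinuousLinearMap fun _ => L := by
    have e := L.iteratedFDerivWithin_comp_right hΘ' hshift.uniqueDiffOn hpre.uniqueDiffOn (x := u)
      huO (i := j) (mod_cast le_top)
    rw [iteratedFDerivWithin_of_isOpen j hpre huO,
      iteratedFDerivWithin_of_isOpen j hshift huO, iteratedFDeriv_comp_add_left] at e
    rw [iteratedFDerivWithin_of_isOpen j hO (hKO hu)]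
    exact e
  have hc0 : 0 ≤ c := (norm_nonneg _).trans (hc j hjk _ hu)
  have hA1 : (1 : ℝ) ≤ max A 1 := le_max_right _ _
  have hL' : ‖L‖ ≤ max A 1 * ρ := hL.trans (by gcongr; exact le_max_left _ _)
  have h3 : ‖L‖ ^ j ≤ max A 1 ^ k * ρ := calc
    ‖L‖ ^ j ≤ (max A 1 * ρ) ^ j := by gcongr
    _ = max A 1 ^ j * ρ ^ j := mul_pow _ _ _
    _ ≤ max A 1 ^ k * ρ ^ 1 := by
      gcongr ?_ * ?_
      · exact pow_le_pow_right₀ hA1 hjk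
      · exact pow_le_pow_of_le_one hρ.le hρ1 hj1
    _ = _ := by rw [pow_one]
  rw [h1, h2, norm_smul, norm_inv, Real.norm_of_nonneg hρ.le]
  calc ρ⁻¹ * ‖(iteratedFDerivWithin ℝ j Θ O (a + L u)).compContinuousLinearMap fun _ => L‖
      ≤ ρ⁻¹ * (c * (max A 1 ^ k * ρ)) := by
        gcongr
        refine (ContinuousMultilinearMap.norm_compContinuousLinearMap_le _ _).trans ?_
        simp only [Finset.prod_const, Finset.card_univ, Fintype.card_fin]
        gcongr
        exact hc j hjk _ hu
    _ = c * max A 1 ^ k := by field_simp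

end Calculus

/-! ### Regular charts -/

section Charts

variable {m : ℕ} [NeZero m] {M : Type*} [TopologicalSpace M]
  [ChartedSpace (EuclideanHalfSpace m) M]

/-- A smooth chart of `M`, of no particular shape: a diffeomorphism of an open subset of `M` onto a
subset of `ℝ^m` on which derivatives are unique. -/
structure IsRegularChart (ψ : PartialEquiv M (EuclideanSpace ℝ (Fin m))) : Prop where
  isOpen_source : IsOpen ψ.source
  contMDiffOn : ContMDiffOn (𝓡∂ m) 𝓘(ℝ, EuclideanSpace ℝ (Fin m)) ∞ ψ ψ.source
  contMDiffOn_symm : ContMDiffOn 𝓘(ℝ, EuclideanSpace ℝ (Fin m)) (𝓡∂ m) ∞ ψ.symm ψ.target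
  uniqueDiffOn_target : UniqueDiffOn ℝ ψ.target

/-- The preferred charts of `M` are regular. -/
theorem isRegularChart_extChartAt [IsManifold (𝓡∂ m) ∞ M] (p : M) :
    IsRegularChart (extChartAt (𝓡∂ m) p) where
  isOpen_source := isOpen_extChartAt_source p
  contMDiffOn := by
    rw [extChartAt_source]; exact contMDiffOn_extChartAt
  contMDiffOn_symm := contMDiffOn_extChartAt_symm p
  uniqueDiffOn_target := uniqueDiffOn_extChartAt_target p

namespace IsRegularChart

variable {ψ ψ' : PartialEquiv M (EuclideanSpace ℝ (Fin m))}

theorem mdifferentiableAt (h : IsRegularChart ψ) {p : M} (hp : p ∈ ψ.source) :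
    MDifferentiableAt (𝓡∂ m) 𝓘(ℝ, EuclideanSpace ℝ (Fin m)) ψ p :=
  (h.contMDiffOn.contMDiffAt (h.isOpen_source.mem_nhds hp)).mdifferentiableAt (by simp)

theorem mdifferentiableWithinAt_symm (h : IsRegularChart ψ) {x : EuclideanSpace ℝ (Fin m)}
    (hx : x ∈ ψ.target) :
    MDifferentiableWithinAt 𝓘(ℝ, EuclideanSpace ℝ (Fin m)) (𝓡∂ m) ψ.symm ψ.target x :=
  (h.contMDiffOn_symm x hx).mdifferentiableWithinAt (by simp)

theorem mfderiv_comp_mfderivWithin_symm (h : IsRegularChart ψ) {x : EuclideanSpace ℝ (Fin m)}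
    (hx : x ∈ ψ.target) (ξ : EuclideanSpace ℝ (Fin m)) :
    mfderiv (𝓡∂ m) 𝓘(ℝ, EuclideanSpace ℝ (Fin m)) ψ (ψ.symm x)
      (mfderivWithin 𝓘(ℝ, EuclideanSpace ℝ (Fin m)) (𝓡∂ m) ψ.symm ψ.target x ξ) = ξ := by
  have hu : UniqueMDiffWithinAt 𝓘(ℝ, EuclideanSpace ℝ (Fin m)) ψ.target x :=
    (h.uniqueDiffOn_target x hx).uniqueMDiffWithinAt
  have h1 := mfderiv_comp_mfderivWithin x (h.mdifferentiableAt (ψ.map_target hx))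
    (h.mdifferentiableWithinAt_symm hx) hu
  have h2 : mfderivWithin 𝓘(ℝ, EuclideanSpace ℝ (Fin m)) 𝓘(ℝ, EuclideanSpace ℝ (Fin m))
      (ψ ∘ ψ.symm) ψ.target x = mfderivWithin 𝓘(ℝ, EuclideanSpace ℝ (Fin m))
        𝓘(ℝ, EuclideanSpace ℝ (Fin m)) id ψ.target x :=
    mfderivWithin_congr (fun y hy => ψ.right_inv hy) (ψ.right_inv hx)
  rw [h2, mfderivWithin_id hu] at h1
  exact (DFunLike.congr_fun h1 ξ).symm

theorem mfderivWithin_symm_comp_mfderiv (h : IsRegularChart ψ) {p : M} (hp : p ∈ ψ.source)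
    (v : TangentSpace (𝓡∂ m) p) :
    mfderivWithin 𝓘(ℝ, EuclideanSpace ℝ (Fin m)) (𝓡∂ m) ψ.symm ψ.target (ψ p)
      (mfderiv (𝓡∂ m) 𝓘(ℝ, EuclideanSpace ℝ (Fin m)) ψ p v) = v := by
  have hu : UniqueMDiffWithinAt (𝓡∂ m) ψ.source p := h.isOpen_source.uniqueMDiffWithinAt hp
  have h1 := mfderivWithin_comp p (h.mdifferentiableWithinAt_symm (ψ.map_source hp))
    (h.mdifferentiableAt hp).mdifferentiableWithinAt (fun q hq => ψ.map_source hq) hu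
  have h2 : mfderivWithin (𝓡∂ m) (𝓡∂ m) (ψ.symm ∘ ψ) ψ.source p =
      mfderivWithin (𝓡∂ m) (𝓡∂ m) id ψ.source p :=
    mfderivWithin_congr (fun y hy => ψ.left_inv hy) (ψ.left_inv hp)
  rw [h2, mfderivWithin_id hu, mfderivWithin_of_isOpen h.isOpen_source hp] at h1
  exact (DFunLike.congr_fun h1 v).symm

/-- A point with an open coordinate neighbourhood in `ℝ^m` is an interior point of `M`. -/
theorem isInteriorPoint (h : IsRegularChart ψ) {p : M} (hp : p ∈ ψ.source)
    (ht : ψ.target ∈ 𝓝 (ψ p)) [IsManifold (𝓡∂ m) ∞ M] : (𝓡∂ m).IsInteriorPoint p := by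
  have hx := ψ.map_source hp
  have hd : MDifferentiableAt 𝓘(ℝ, EuclideanSpace ℝ (Fin m)) (𝓡∂ m) ψ.symm (ψ p) :=
    (h.mdifferentiableWithinAt_symm hx).mdifferentiableAt ht
  have hs : Function.Surjective
      (mfderiv 𝓘(ℝ, EuclideanSpace ℝ (Fin m)) (𝓡∂ m) ψ.symm (ψ p)) := by
    intro v
    rw [← mfderivWithin_of_mem_nhds ht]
    have e : ψ.symm (ψ p) = p := ψ.left_inv hp
    exact ⟨_, h.mfderivWithin_symm_comp_mfderiv hp v⟩
  have := hd.isInteriorPoint_of_surjective_mfderiv hs BoundarylessManifold.isInteriorPoint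
  rwa [ψ.left_inv hp] at this

/-- A chart with values in the half-space maps interior points of `M` to its interior. -/
theorem zero_lt_of_isInteriorPoint (h : IsRegularChart ψ) (hH : ψ.target ⊆ halfSpace m) {p : M}
    (hp : p ∈ ψ.source) [IsManifold (𝓡∂ m) ∞ M] (hi : (𝓡∂ m).IsInteriorPoint p) : 0 < ψ p 0 := by
  set e := extChartAt (𝓡∂ m) p with he
  have hep : e p ∈ interior (range (𝓡∂ m)) := hi
  have hemem : e.target ∈ 𝓝 (e p) := by
    have := extChartAt_target_mem_nhdsWithin (I := 𝓡∂ m) p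
    rwa [nhdsWithin_eq_nhds.2 (mem_interior_iff_mem_nhds.1 hep)] at this
  have hsymm : e.symm (e p) = p := extChartAt_to_inv p
  have hcs : ContMDiffAt 𝓘(ℝ, EuclideanSpace ℝ (Fin m)) (𝓡∂ m) ∞ e.symm (e p) :=
    (contMDiffOn_extChartAt_symm p).contMDiffAt hemem
  have hds : MDifferentiableAt 𝓘(ℝ, EuclideanSpace ℝ (Fin m)) (𝓡∂ m) e.symm (e p) :=
    hcs.mdifferentiableAt (by simp)
  have hdc : MDifferentiableAt 𝓘(ℝ, EuclideanSpace ℝ (Fin m)) 𝓘(ℝ, EuclideanSpace ℝ (Fin m))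
      (ψ ∘ e.symm) (e p) :=
    MDifferentiableAt.comp (e p) (hsymm.symm ▸ h.mdifferentiableAt hp) hds
  have hpre : e.symm ⁻¹' ψ.source ∈ 𝓝 (e p) :=
    hcs.continuousAt.preimage_mem_nhds (hsymm.symm ▸ h.isOpen_source.mem_nhds hp)
  have hsurj : Function.Surjective (fderiv ℝ (ψ ∘ e.symm) (e p)) := by
    intro ξ
    have heR := isRegularChart_extChartAt (m := m) p
    set B : EuclideanSpace ℝ (Fin m) →L[ℝ] EuclideanSpace ℝ (Fin m) :=
      mfderivWithin 𝓘(ℝ, EuclideanSpace ℝ (Fin m)) (𝓡∂ m) ψ.symm ψ.target (ψ p) with hB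
    set C : EuclideanSpace ℝ (Fin m) →L[ℝ] EuclideanSpace ℝ (Fin m) :=
      mfderiv (𝓡∂ m) 𝓘(ℝ, EuclideanSpace ℝ (Fin m)) e p with hC
    have key : ∀ q, ψ.symm (ψ p) = q →
        (mfderiv (𝓡∂ m) 𝓘(ℝ, EuclideanSpace ℝ (Fin m)) ψ q :
          EuclideanSpace ℝ (Fin m) →L[ℝ] EuclideanSpace ℝ (Fin m)) (B ξ) = ξ := by
      rintro _ rfl
      exact h.mfderiv_comp_mfderivWithin_symm (ψ.map_source hp) ξ
    have key2 : (mfderiv 𝓘(ℝ, EuclideanSpace ℝ (Fin m)) (𝓡∂ m) e.symm (e p) :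
          EuclideanSpace ℝ (Fin m) →L[ℝ] EuclideanSpace ℝ (Fin m)) (C (B ξ)) = B ξ := by
      rw [← mfderivWithin_of_mem_nhds hemem]
      exact heR.mfderivWithin_symm_comp_mfderiv (mem_extChartAt_source p) (B ξ)
    refine ⟨C (B ξ), ?_⟩
    rw [← mfderiv_eq_fderiv, mfderiv_comp (e p) (hsymm.symm ▸ h.mdifferentiableAt hp) hds]
    have := key _ ((ψ.left_inv hp).trans hsymm.symm)
    refine Eq.trans ?_ this
    exact congrArg (mfderiv (𝓡∂ m) 𝓘(ℝ, EuclideanSpace ℝ (Fin m)) ψ (e.symm (e p)) :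
          EuclideanSpace ℝ (Fin m) →L[ℝ] EuclideanSpace ℝ (Fin m)) key2
  have hset : halfSpace m = {y : EuclideanSpace ℝ (Fin m) | 0 ≤ y 0} := rfl
  have := hdc.differentiableAt.mem_interior_convex_of_surjective_fderiv hpre
    (s := halfSpace m) EuclideanHalfSpace.convex (isClosed_le (by fun_prop) (by fun_prop))
    (by rw [hset, interior_halfSpace]; exact ⟨WithLp.toLp 2 fun _ => 1, by simp⟩)
    (fun y hy => hH (ψ.map_source hy)) hsurj
  rw [hset, interior_halfSpace] at this
  simpa [hsymm] using this

end IsRegularChart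

variable [IsManifold (𝓡∂ m) ∞ M]

theorem IsRegularChart.contDiffOn_pushforwardMetric
    {ψ : PartialEquiv M (EuclideanSpace ℝ (Fin m))} (h : IsRegularChart ψ) (g : Metric m M) :
    ContDiffOn ℝ ∞ (pushforwardMetric g ψ) ψ.target := by
  have hum : UniqueMDiffOn 𝓘(ℝ, EuclideanSpace ℝ (Fin m)) ψ.target :=
    h.uniqueDiffOn_target.uniqueMDiffOn
  have hT := h.contMDiffOn_symm.contMDiffOn_tangentMapWithin (m := ∞) (by simp) hum
  have hv (ξ : EuclideanSpace ℝ (Fin m)) :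
      ContMDiffOn 𝓘(ℝ, EuclideanSpace ℝ (Fin m)) (𝓡∂ m).tangent ∞
      (fun x => (Bundle.TotalSpace.mk' (EuclideanSpace ℝ (Fin m)) (ψ.symm x)
        (mfderivWithin 𝓘(ℝ, EuclideanSpace ℝ (Fin m)) (𝓡∂ m) ψ.symm ψ.target x ξ) :
        TangentBundle (𝓡∂ m) M)) ψ.target := by
    have hc : ContMDiff 𝓘(ℝ, EuclideanSpace ℝ (Fin m))
        (𝓘(ℝ, EuclideanSpace ℝ (Fin m))).tangent ∞
        (fun x : EuclideanSpace ℝ (Fin m) => (⟨x, ξ⟩ : TangentBundle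
          𝓘(ℝ, EuclideanSpace ℝ (Fin m)) (EuclideanSpace ℝ (Fin m)))) :=
      contMDiff_vectorSpace_iff_contDiff.2 contDiff_const
    exact hT.comp hc.contMDiffOn (fun x hx => hx)
  refine contDiffOn_clm_apply.2 fun ξ => contDiffOn_clm_apply.2 fun η => ?_
  rw [← contMDiffOn_iff_contDiffOn]
  have hg := g.contMDiff.comp_contMDiffOn h.contMDiffOn_symm
  have := ContMDiffOn.clm_bundle_apply₂ (F₁ := EuclideanSpace ℝ (Fin m))
    (F₂ := EuclideanSpace ℝ (Fin m)) (F₃ := ℝ) (E₃ := Bundle.Trivial M ℝ) hg (hv ξ) (hv η)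
  intro x hx
  have h2 := this x hx
  simp only [Bundle.contMDiffWithinAt_totalSpace] at h2
  exact h2.2

theorem IsRegularChart.pushforwardMetric_pos
    {ψ : PartialEquiv M (EuclideanSpace ℝ (Fin m))} (h : IsRegularChart ψ) (g : Metric m M)
    {x : EuclideanSpace ℝ (Fin m)} (hx : x ∈ ψ.target) {ξ : EuclideanSpace ℝ (Fin m)}
    (hξ : ξ ≠ 0) : 0 < pushforwardMetric g ψ x ξ ξ := by
  refine g.pos (ψ.symm x)
    (mfderivWithin 𝓘(ℝ, EuclideanSpace ℝ (Fin m)) (𝓡∂ m) ψ.symm ψ.target x ξ) fun h0 => hξ ?_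
  rw [← h.mfderiv_comp_mfderivWithin_symm hx ξ, h0, map_zero]
  rfl

/-- In a chart, the metric of an end is the pullback of the Euclidean metric by the local
representation of the isometry. -/
theorem IsIsometryOnto.pushforwardMetric_apply {g : Metric m M} {d : ℕ} {V : Set M}
    {F : Set (WithLp 2 (ℝ × EuclideanSpace ℝ (Fin d)))}
    {Φ : PartialEquiv M (WithLp 2 (ℝ × EuclideanSpace ℝ (Fin d)))} (hΦ : IsIsometryOnto g V F Φ)
    (hV : IsOpen V) {ψ : PartialEquiv M (EuclideanSpace ℝ (Fin m))} (h : IsRegularChart ψ)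
    {x : EuclideanSpace ℝ (Fin m)} (hx : x ∈ ψ.target) (hxV : ψ.symm x ∈ V)
    (ξ η : EuclideanSpace ℝ (Fin m)) :
    pushforwardMetric g ψ x ξ η = inner ℝ (fderivWithin ℝ (Φ ∘ ψ.symm) ψ.target x ξ)
      (fderivWithin ℝ (Φ ∘ ψ.symm) ψ.target x η) := by
  have hu : UniqueMDiffWithinAt 𝓘(ℝ, EuclideanSpace ℝ (Fin m)) ψ.target x :=
    (h.uniqueDiffOn_target x hx).uniqueMDiffWithinAt
  have hd : MDifferentiableAt (𝓡∂ m) 𝓘(ℝ, WithLp 2 (ℝ × EuclideanSpace ℝ (Fin d))) Φ (ψ.symm x) :=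
    (hΦ.contMDiffOn.contMDiffAt (hV.mem_nhds hxV)).mdifferentiableAt (by simp)
  rw [← mfderivWithin_eq_fderivWithin,
    mfderiv_comp_mfderivWithin x hd (h.mdifferentiableWithinAt_symm hx) hu]
  exact (hΦ.inner_eq _ hxV _ _).symm

theorem IsIsometryOnto.differentiableWithinAt_comp_symm {g : Metric m M} {d : ℕ} {V : Set M}
    {F : Set (WithLp 2 (ℝ × EuclideanSpace ℝ (Fin d)))}
    {Φ : PartialEquiv M (WithLp 2 (ℝ × EuclideanSpace ℝ (Fin d)))} (hΦ : IsIsometryOnto g V F Φ)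
    (hV : IsOpen V) {ψ : PartialEquiv M (EuclideanSpace ℝ (Fin m))} (h : IsRegularChart ψ)
    {x : EuclideanSpace ℝ (Fin m)} (hx : x ∈ ψ.target) (hxV : ψ.symm x ∈ V) :
    DifferentiableWithinAt ℝ (Φ ∘ ψ.symm) ψ.target x := by
  have hd : MDifferentiableAt (𝓡∂ m) 𝓘(ℝ, WithLp 2 (ℝ × EuclideanSpace ℝ (Fin d))) Φ (ψ.symm x) :=
    (hΦ.contMDiffOn.contMDiffAt (hV.mem_nhds hxV)).mdifferentiableAt (by simp)
  exact (MDifferentiableAt.comp_mdifferentiableWithinAt x hd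
    (h.mdifferentiableWithinAt_symm hx)).differentiableWithinAt

end Charts

/-! ### Charts with relatively compact domain -/

section Cube

theorem isOpen_cube {m : ℕ} (r : ℝ) : IsOpen (cube m r) := by
  have : cube m r = ⋂ i, {x : EuclideanSpace ℝ (Fin m) | |x i| < r} := by
    ext x; simp [cube]
  rw [this]
  exact isOpen_iInter_of_finite fun i => isOpen_lt (by fun_prop) (by fun_prop)

theorem norm_le_of_mem_cube {m : ℕ} {x : EuclideanSpace ℝ (Fin m)} (hx : x ∈ cube m 1) :
    ‖x‖ ≤ √m := by
  rw [EuclideanSpace.norm_eq]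
  apply Real.sqrt_le_sqrt
  calc ∑ i, ‖x i‖ ^ 2 ≤ ∑ _i : Fin m, (1 : ℝ) := by
        gcongr with i
        exact pow_le_one₀ (norm_nonneg _) (hx i).le
    _ = m := by simp

end Cube

section Tight

variable {m : ℕ} [NeZero m] {M : Type*} [TopologicalSpace M]
  [ChartedSpace (EuclideanHalfSpace m) M]

/-- The restriction of a chart to the preimage of the unit cube. -/
def cubeRestr (ψ : PartialEquiv M (EuclideanSpace ℝ (Fin m))) :
    PartialEquiv M (EuclideanSpace ℝ (Fin m)) where
  toFun := ψ
  invFun := ψ.symm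
  source := ψ.source ∩ ψ ⁻¹' cube m 1
  target := ψ.target ∩ cube m 1
  map_source' p hp := ⟨ψ.map_source hp.1, hp.2⟩
  map_target' x hx := ⟨ψ.map_target hx.1, by rw [mem_preimage, ψ.right_inv hx.1]; exact hx.2⟩
  left_inv' p hp := ψ.left_inv hp.1
  right_inv' x hx := ψ.right_inv hx.1

theorem IsRegularChart.cubeRestr {ψ : PartialEquiv M (EuclideanSpace ℝ (Fin m))}
    (h : IsRegularChart ψ) : IsRegularChart (cubeRestr ψ) where
  isOpen_source := h.contMDiffOn.continuousOn.isOpen_inter_preimage h.isOpen_source (isOpen_cube 1)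
  contMDiffOn := h.contMDiffOn.mono inter_subset_left
  contMDiffOn_symm := h.contMDiffOn_symm.mono inter_subset_left
  uniqueDiffOn_target := h.uniqueDiffOn_target.inter (isOpen_cube 1)

/-- `κ` is the restriction of a larger chart `ψ` to the preimage of the unit cube, and its domain is
relatively compact in the domain of `ψ`. Quantities attached to a single such chart, or to a pair of
them, are bounded by compactness. -/
def IsTight (κ : PartialEquiv M (EuclideanSpace ℝ (Fin m))) : Prop :=
  ∃ ψ : PartialEquiv M (EuclideanSpace ℝ (Fin m)), IsRegularChart ψ ∧ κ = cubeRestr ψ ∧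
    ∃ K, IsCompact K ∧ K ⊆ ψ.target ∧ ψ.target ∩ cube m 1 ⊆ K

namespace IsTight

variable {κ κ' : PartialEquiv M (EuclideanSpace ℝ (Fin m))}

theorem isRegularChart (h : IsTight κ) : IsRegularChart κ := by
  obtain ⟨ψ, hψ, rfl, -⟩ := h
  exact hψ.cubeRestr

theorem exists_isCompact_superset (h : IsTight κ) : ∃ L : Set M, IsCompact L ∧ κ.source ⊆ L := by
  obtain ⟨ψ, hψ, rfl, K, hK, hKt, hKc⟩ := h
  refine ⟨ψ.symm '' K, hK.image_of_continuousOn (hψ.contMDiffOn_symm.continuousOn.mono hKt),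
    fun p hp => ⟨ψ p, hKc ⟨ψ.map_source hp.1, hp.2⟩, ψ.left_inv hp.1⟩⟩

theorem exists_bcNormLE_transition [T2Space M] (h : IsTight κ) (h' : IsTight κ') (k : ℕ) :
    ∃ c : ℝ, BCNormLE k (κ' ∘ κ.symm) (κ '' (κ.source ∩ κ'.source)) c := by
  have hs' : IsOpen κ'.source := h'.isRegularChart.isOpen_source
  obtain ⟨ψ, hψ, rfl, K, hK, hKt, hKc⟩ := h
  obtain ⟨ψ', hψ', rfl, K', hK', hKt', hKc'⟩ := h'
  have hcs := hψ.contMDiffOn_symm.continuousOn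
  have hcs' := hψ'.contMDiffOn_symm.continuousOn
  have hL' : IsCompact (ψ'.symm '' K') := hK'.image_of_continuousOn (hcs'.mono hKt')
  have hLs' : ψ'.symm '' K' ⊆ ψ'.source := by
    rintro _ ⟨x, hx, rfl⟩; exact ψ'.map_target (hKt' hx)
  -- `ψ' ∘ ψ.symm` is smooth on `ψ.target ∩ O`, and the points that it maps to the compact closure
  -- of the cube form a compact subset
  obtain ⟨O, hO, hO'⟩ := continuousOn_iff'.1 hcs _ hψ'.isOpen_source
  obtain ⟨U, hU, hU'⟩ := continuousOn_iff'.1 hcs _ hs'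
  have hS : UniqueDiffOn ℝ (ψ.target ∩ O) := hψ.uniqueDiffOn_target.inter hO
  have hf : ContDiffOn ℝ ∞ (ψ' ∘ ψ.symm) (ψ.target ∩ O) := by
    rw [← contMDiffOn_iff_contDiffOn]
    refine hψ'.contMDiffOn.comp (hψ.contMDiffOn_symm.mono inter_subset_left) fun x hx => ?_
    rw [inter_comm, ← hO'] at hx
    exact hx.1
  have hKK : IsCompact (K ∩ ψ.symm ⁻¹' (ψ'.symm '' K')) :=
    hK.of_isClosed_subset
      ((hcs.mono hKt).preimage_isClosed_of_isClosed hK.isClosed hL'.isClosed) inter_subset_left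
  refine exists_bcNormLE_of_compact hS hf hKK ?_ ?_ ?_ k
  · rintro x ⟨hx, hx'⟩
    have : x ∈ ψ.symm ⁻¹' ψ'.source ∩ ψ.target := ⟨hLs' hx', hKt hx⟩
    rw [hO'] at this
    exact ⟨this.2, this.1⟩
  · rintro _ ⟨p, ⟨hp, hp'⟩, rfl⟩
    refine ⟨hKc ⟨ψ.map_source hp.1, hp.2⟩, ψ' p, hKc' ⟨ψ'.map_source hp'.1, hp'.2⟩, ?_⟩
    exact (ψ'.left_inv hp'.1).trans (ψ.left_inv hp.1).symm
  · refine ⟨cube m 1 ∩ U, (isOpen_cube 1).inter hU, ?_⟩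
    ext x
    constructor
    · rintro ⟨p, ⟨hp, hp'⟩, rfl⟩
      have e : ψ.symm (ψ p) = p := ψ.left_inv hp.1
      have h1 : ψ p ∈ ψ.symm ⁻¹' ψ'.source ∩ ψ.target :=
        ⟨by rw [mem_preimage, e]; exact hp'.1, ψ.map_source hp.1⟩
      have h2 : ψ p ∈ ψ.symm ⁻¹' (cubeRestr ψ').source ∩ ψ.target :=
        ⟨by rw [mem_preimage, e]; exact hp', ψ.map_source hp.1⟩
      rw [hO'] at h1
      rw [hU'] at h2
      exact ⟨⟨h1.2, h1.1⟩, hp.2, h2.1⟩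
    · rintro ⟨⟨hx, -⟩, hxc, hxU⟩
      have h2 : x ∈ ψ.symm ⁻¹' (cubeRestr ψ').source ∩ ψ.target := by rw [hU']; exact ⟨hxU, hx⟩
      refine ⟨ψ.symm x, ⟨⟨ψ.map_target hx, ?_⟩, h2.1⟩, ψ.right_inv hx⟩
      rw [mem_preimage, ψ.right_inv hx]; exact hxc

variable [IsManifold (𝓡∂ m) ∞ M]

theorem _root_.TameEnds.pushforwardMetric_cubeRestr (g : Metric m M)
    (ψ : PartialEquiv M (EuclideanSpace ℝ (Fin m))) {x : EuclideanSpace ℝ (Fin m)}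
    (hx : x ∈ cube m 1) : pushforwardMetric g (cubeRestr ψ) x = pushforwardMetric g ψ x := by
  have : mfderivWithin 𝓘(ℝ, EuclideanSpace ℝ (Fin m)) (𝓡∂ m) ψ.symm (ψ.target ∩ cube m 1) x =
      mfderivWithin 𝓘(ℝ, EuclideanSpace ℝ (Fin m)) (𝓡∂ m) ψ.symm ψ.target x :=
    mfderivWithin_inter ((isOpen_cube 1).mem_nhds hx)
  ext ξ η
  change g.inner (ψ.symm x) (mfderivWithin _ _ ψ.symm (ψ.target ∩ cube m 1) x ξ)
    (mfderivWithin _ _ ψ.symm (ψ.target ∩ cube m 1) x η) = _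
  rw [this]
  rfl

theorem exists_bcNormLE_pushforwardMetric (h : IsTight κ) (g : Metric m M) (k : ℕ) :
    ∃ c : ℝ, BCNormLE k (pushforwardMetric g κ) κ.target c := by
  obtain ⟨ψ, hψ, rfl, K, hK, hKt, hKc⟩ := h
  obtain ⟨c, hc⟩ := exists_bcNormLE_of_compact hψ.uniqueDiffOn_target
    (hψ.contDiffOn_pushforwardMetric g) hK hKt hKc ⟨_, isOpen_cube 1, rfl⟩ k
  exact ⟨c, BCNormLE.congr hc fun x hx => pushforwardMetric_cubeRestr g ψ hx.2⟩

theorem exists_equivalent_pushforwardMetric (h : IsTight κ) (g : Metric m M) :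
    ∃ c : ℝ, 1 ≤ c ∧ ∀ x ∈ κ.target, ∀ ξ : EuclideanSpace ℝ (Fin m),
      ‖ξ‖ ^ 2 / c ≤ pushforwardMetric g κ x ξ ξ ∧ pushforwardMetric g κ x ξ ξ ≤ c * ‖ξ‖ ^ 2 := by
  obtain ⟨ψ, hψ, rfl, K, hK, hKt, hKc⟩ := h
  set P := pushforwardMetric g ψ with hP
  have hPc : ContinuousOn P K := (hψ.contDiffOn_pushforwardMetric g).continuousOn.mono hKt
  set S : Set (EuclideanSpace ℝ (Fin m)) := Metric.sphere 0 1
  have hKS : IsCompact (K ×ˢ S) := hK.prod (isCompact_sphere 0 1)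
  have hfc : ContinuousOn (fun y : EuclideanSpace ℝ (Fin m) × EuclideanSpace ℝ (Fin m) =>
      P y.1 y.2 y.2) (K ×ˢ S) :=
    ((hPc.comp continuousOn_fst fun y hy => hy.1).clm_apply continuousOn_snd).clm_apply
      continuousOn_snd
  obtain ⟨b, hb⟩ := hKS.exists_bound_of_continuousOn hfc
  have hpos : ∀ y ∈ K ×ˢ S, 0 < P y.1 y.2 y.2 := fun y hy =>
    hψ.pushforwardMetric_pos g (hKt hy.1) (by
      rintro h0; have := hy.2; simp [S, h0] at this)
  obtain ⟨a, ha, hab⟩ : ∃ a : ℝ, 0 < a ∧ ∀ y ∈ K ×ˢ S, a ≤ P y.1 y.2 y.2 := by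
    rcases (K ×ˢ S).eq_empty_or_nonempty with h0 | hne
    · exact ⟨1, one_pos, by simp [h0]⟩
    · obtain ⟨y, hy, hmin⟩ := hKS.exists_isMinOn hne hfc
      exact ⟨_, hpos y hy, fun z hz => hmin hz⟩
  refine ⟨max 1 (max b a⁻¹), le_max_left _ _, fun x hx ξ => ?_⟩
  rw [pushforwardMetric_cubeRestr g ψ hx.2, ← hP]
  have hxK : x ∈ K := hKc hx
  rcases eq_or_ne ξ 0 with rfl | hξ
  · simp
  have hn : 0 < ‖ξ‖ := norm_pos_iff.2 hξ
  set η := ‖ξ‖⁻¹ • ξ with hη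
  have hηS : η ∈ S := by simp [S, hη, norm_smul, hn.ne']
  have hξη : ξ = ‖ξ‖ • η := by rw [hη, smul_inv_smul₀ hn.ne']
  have hval : P x ξ ξ = ‖ξ‖ ^ 2 * P x η η := by
    conv_lhs => rw [hξη]
    simp only [map_smul, smul_apply, smul_eq_mul]; ring
  have h1 := hab (x, η) ⟨hxK, hηS⟩
  have h2 := (le_abs_self _).trans (hb (x, η) ⟨hxK, hηS⟩)
  simp only at h1 h2
  rw [hval]
  constructor
  · rw [div_eq_mul_inv]
    gcongr
    refine le_trans ?_ h1
    rw [inv_le_comm₀ (by positivity) ha]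
    exact (le_max_right _ _).trans (le_max_right _ _)
  · rw [mul_comm]
    gcongr
    exact h2.trans ((le_max_left _ _).trans (le_max_right _ _))

end IsTight

end Tight

/-! ### Normalized charts onto coordinate boxes -/

section Box

theorem uniqueDiffOn_halfSpace (m : ℕ) [NeZero m] : UniqueDiffOn ℝ (halfSpace m) := by
  have hset : halfSpace m = {y : EuclideanSpace ℝ (Fin m) | 0 ≤ y 0} := rfl
  refine uniqueDiffOn_convex EuclideanHalfSpace.convex ?_
  rw [hset, interior_halfSpace]
  exact ⟨WithLp.toLp 2 fun _ => 1, by simp⟩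

/-- The affine map `u ↦ c + w u` (coordinatewise) from `[-1, 1]^m` onto the box with center `c` and
half side lengths `w`. -/
def boxMap {m : ℕ} (c w : EuclideanSpace ℝ (Fin m)) (hw : ∀ i, 0 < w i) :
    EuclideanSpace ℝ (Fin m) ≃ EuclideanSpace ℝ (Fin m) where
  toFun u := WithLp.toLp 2 fun i => c i + w i * u i
  invFun x := WithLp.toLp 2 fun i => (x i - c i) / w i
  left_inv u := by ext i; simp [(hw i).ne']
  right_inv x := by ext i; simp [mul_div_cancel₀ _ (hw i).ne']

theorem contDiff_boxMap {m : ℕ} (c w : EuclideanSpace ℝ (Fin m)) (hw : ∀ i, 0 < w i) :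
    ContDiff ℝ ∞ (boxMap c w hw) := by
  rw [contDiff_euclidean]; intro i
  change ContDiff ℝ ∞ fun u : EuclideanSpace ℝ (Fin m) => c i + w i * u i
  fun_prop

theorem contDiff_boxMap_symm {m : ℕ} (c w : EuclideanSpace ℝ (Fin m)) (hw : ∀ i, 0 < w i) :
    ContDiff ℝ ∞ (boxMap c w hw).symm := by
  rw [contDiff_euclidean]; intro i
  change ContDiff ℝ ∞ fun x : EuclideanSpace ℝ (Fin m) => (x i - c i) / w i
  fun_prop

section

variable {m : ℕ} {M : Type*}

/-- The chart `ψ`, restricted to the preimage of the box with center `c` and half side lengths `w`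
and rescaled to the unit cube. -/
def boxChart (ψ : PartialEquiv M (EuclideanSpace ℝ (Fin m))) (c w : EuclideanSpace ℝ (Fin m))
    (hw : ∀ i, 0 < w i) : PartialEquiv M (EuclideanSpace ℝ (Fin m)) :=
  cubeRestr (ψ.transEquiv (boxMap c w hw).symm)

variable {ψ : PartialEquiv M (EuclideanSpace ℝ (Fin m))} {c w : EuclideanSpace ℝ (Fin m)}
  {hw : ∀ i, 0 < w i}

theorem boxChart_apply (p : M) (i : Fin m) : boxChart ψ c w hw p i = (ψ p i - c i) / w i := rfl

theorem mem_boxChart_target {u : EuclideanSpace ℝ (Fin m)} :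
    u ∈ (boxChart ψ c w hw).target ↔ boxMap c w hw u ∈ ψ.target ∧ u ∈ cube m 1 := Iff.rfl

theorem mem_boxChart_source {p : M} :
    p ∈ (boxChart ψ c w hw).source ↔ p ∈ ψ.source ∧ ∀ i, |ψ p i - c i| < w i := by
  refine and_congr Iff.rfl (forall_congr' fun i => ?_)
  change |(ψ p i - c i) / w i| < 1 ↔ _
  rw [abs_div, abs_of_pos (hw i), div_lt_one (hw i)]

theorem boxChart_mem_cube {p : M} {r : ℝ} :
    boxChart ψ c w hw p ∈ cube m r ↔ ∀ i, |ψ p i - c i| < r * w i := by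
  refine forall_congr' fun i => ?_
  rw [boxChart_apply, abs_div, abs_of_pos (hw i), div_lt_iff₀ (hw i)]

end

variable {m : ℕ} [NeZero m] {M : Type*} [TopologicalSpace M]
  [ChartedSpace (EuclideanHalfSpace m) M]

/-- A regular chart onto a relatively open subset of the closed half-space. -/
structure IsHalfChart (ψ : PartialEquiv M (EuclideanSpace ℝ (Fin m))) : Prop extends
    IsRegularChart ψ where
  target_eq : ∃ O, IsOpen O ∧ ψ.target = O ∩ halfSpace m

theorem IsHalfChart.of_target_eq {ψ : PartialEquiv M (EuclideanSpace ℝ (Fin m))}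
    (h₁ : IsOpen ψ.source)
    (h₂ : ContMDiffOn (𝓡∂ m) 𝓘(ℝ, EuclideanSpace ℝ (Fin m)) ∞ ψ ψ.source)
    (h₃ : ContMDiffOn 𝓘(ℝ, EuclideanSpace ℝ (Fin m)) (𝓡∂ m) ∞ ψ.symm ψ.target)
    {O : Set (EuclideanSpace ℝ (Fin m))} (hO : IsOpen O) (h : ψ.target = O ∩ halfSpace m) :
    IsHalfChart ψ where
  isOpen_source := h₁
  contMDiffOn := h₂
  contMDiffOn_symm := h₃
  uniqueDiffOn_target := by
    rw [h, inter_comm]; exact (uniqueDiffOn_halfSpace m).inter hO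
  target_eq := ⟨O, hO, h⟩

theorem isHalfChart_extChartAt [IsManifold (𝓡∂ m) ∞ M] (p : M) :
    IsHalfChart (extChartAt (𝓡∂ m) p) where
  toIsRegularChart := isRegularChart_extChartAt p
  target_eq := by
    refine ⟨(𝓡∂ m).symm ⁻¹' (chartAt (EuclideanHalfSpace m) p).target,
      (chartAt (EuclideanHalfSpace m) p).open_target.preimage (𝓡∂ m).continuous_symm, ?_⟩
    rw [extChartAt_target, range_modelWithCornersEuclideanHalfSpace]
    rfl

theorem IsHalfChart.target_subset {ψ : PartialEquiv M (EuclideanSpace ℝ (Fin m))}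
    (h : IsHalfChart ψ) : ψ.target ⊆ halfSpace m := by
  obtain ⟨O, -, hO⟩ := h.target_eq
  rw [hO]; exact inter_subset_right

variable {ψ : PartialEquiv M (EuclideanSpace ℝ (Fin m))} {c w : EuclideanSpace ℝ (Fin m)}
  {hw : ∀ i, 0 < w i}

variable [IsManifold (𝓡∂ m) ∞ M]

/-- If the closed box lies in the target of `ψ` (inside the half-space) and is either centered on
the boundary of the half-space or does not cross it, then `boxChart ψ c w hw` is a normalized chart
with relatively compact domain. -/
theorem IsHalfChart.boxChart (h : IsHalfChart ψ) (hc : c 0 = 0 ∨ w 0 ≤ c 0)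
    (hbox : ∀ x ∈ halfSpace m, (∀ i, |x i - c i| ≤ w i) → x ∈ ψ.target) :
    IsTight (boxChart ψ c w hw) ∧ IsNormalizedChart (boxChart ψ c w hw) := by
  set e := boxMap c w hw with he
  have hee (u : EuclideanSpace ℝ (Fin m)) (i) : e u i = c i + w i * u i := rfl
  obtain ⟨O, hO, hOt⟩ := h.target_eq
  have hrescale : IsRegularChart (ψ.transEquiv e.symm) := by
    refine ⟨h.isOpen_source, ?_, ?_, ?_⟩
    · exact (contDiff_boxMap_symm c w hw).contMDiff.comp_contMDiffOn h.contMDiffOn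
    · exact h.contMDiffOn_symm.comp (contDiff_boxMap c w hw).contMDiff.contMDiffOn
        fun u hu => hu
    · have ht : (ψ.transEquiv e.symm).target = (e ⁻¹' halfSpace m) ∩ (e ⁻¹' O) := by
        change e ⁻¹' ψ.target = _
        rw [hOt, inter_comm, preimage_inter]
      rw [ht]
      refine UniqueDiffOn.inter ?_ (hO.preimage (contDiff_boxMap c w hw).continuous)
      have hset : e ⁻¹' halfSpace m = {u : EuclideanSpace ℝ (Fin m) | -(c 0) / w 0 ≤ u 0} := by
        ext u
        change 0 ≤ c 0 + w 0 * u 0 ↔ -(c 0) / w 0 ≤ u 0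
        rw [div_le_iff₀ (hw 0)]
        constructor <;> intro h' <;> linarith
      rw [hset]
      set q : ℝ := -(c 0) / w 0
      refine uniqueDiffOn_convex ?_ ?_
      · intro x hx y hy a b ha hb hab
        simp only [mem_ofPred_eq, PiLp.add_apply, PiLp.smul_apply, smul_eq_mul] at *
        nlinarith [mul_le_mul_of_nonneg_left hx ha, mul_le_mul_of_nonneg_left hy hb,
          congrArg (· * q) hab]
      · rw [interior_halfSpace]
        exact ⟨WithLp.toLp 2 fun _ => q + 1, by simp⟩
  have htight : IsTight (TameEnds.boxChart ψ c w hw) := by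
    refine ⟨_, hrescale, rfl, {u | (∀ i, |u i| ≤ 1) ∧ e u ∈ halfSpace m}, ?_, ?_, ?_⟩
    · refine Metric.isCompact_of_isClosed_isBounded ?_ ?_
      · refine IsClosed.inter (s₁ := {u : EuclideanSpace ℝ (Fin m) | ∀ i, |u i| ≤ 1})
          (s₂ := {u | e u ∈ halfSpace m}) ?_ ?_
        · simp only [ofPred_forall]
          exact isClosed_iInter fun i => isClosed_le (by fun_prop) (by fun_prop)
        · exact isClosed_le (f := fun _ => (0 : ℝ))
            (g := fun u : EuclideanSpace ℝ (Fin m) => c 0 + w 0 * u 0) (by fun_prop) (by fun_prop)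
      · refine (Metric.isBounded_closedBall (x := (0 : EuclideanSpace ℝ (Fin m)))
          (r := √m)).subset fun u hu => ?_
        rw [mem_closedBall_zero_iff, EuclideanSpace.norm_eq]
        apply Real.sqrt_le_sqrt
        calc ∑ i, ‖u i‖ ^ 2 ≤ ∑ _i : Fin m, (1 : ℝ) := by
              gcongr with i
              exact pow_le_one₀ (norm_nonneg _) (hu.1 i)
          _ = m := by simp
    · rintro u ⟨hu, huH⟩
      refine hbox _ huH fun i => ?_
      change |e u i - c i| ≤ w i
      rw [hee, add_sub_cancel_left, abs_mul, abs_of_pos (hw i)]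
      exact mul_le_of_le_one_right (hw i).le (hu i)
    · rintro u ⟨hu, huc⟩
      exact ⟨fun i => (huc i).le, h.target_subset hu⟩
  have hreg := htight.isRegularChart
  have hmem : ∀ u ∈ cube m 1, e u ∈ halfSpace m → u ∈ (TameEnds.boxChart ψ c w hw).target := by
    intro u hu huH
    refine ⟨hbox _ huH fun i => ?_, hu⟩
    change |e u i - c i| ≤ w i
    rw [hee, add_sub_cancel_left, abs_mul, abs_of_pos (hw i)]
    exact mul_le_of_le_one_right (hw i).le (hu i).le
  have hw0 := hw 0
  refine ⟨htight, hreg.isOpen_source, hreg.contMDiffOn, hreg.contMDiffOn_symm, ?_, ?_⟩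
  · intro hint
    rcases hc with hc | hc
    · exfalso
      have h0c : (0 : EuclideanSpace ℝ (Fin m)) ∈ cube m 1 := fun i => by simp
      have h0 : (0 : EuclideanSpace ℝ (Fin m)) ∈ (TameEnds.boxChart ψ c w hw).target :=
        hmem 0 h0c (by change 0 ≤ e 0 0; rw [hee, hc]; simp)
      have hp := (TameEnds.boxChart ψ c w hw).map_target h0
      have hlt := h.zero_lt_of_isInteriorPoint h.target_subset hp.1 (hint hp)
      have hr : ψ ((TameEnds.boxChart ψ c w hw).symm 0) = e 0 := ψ.right_inv h0.1
      rw [hr, hee, hc] at hlt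
      simp at hlt
    · refine subset_antisymm inter_subset_right fun u hu => hmem u hu ?_
      change 0 ≤ e u 0
      rw [hee]
      have := (abs_lt.1 (hu 0)).1
      nlinarith
  · rintro ⟨p, hp, hpb⟩
    rcases hc with hc | hc
    · ext u
      have : e u ∈ halfSpace m ↔ u ∈ halfSpace m := by
        change 0 ≤ e u 0 ↔ 0 ≤ u 0
        rw [hee, hc, zero_add, mul_nonneg_iff_of_pos_left hw0]
      refine ⟨fun hu => ⟨hu.2, this.1 (h.target_subset hu.1)⟩, fun hu => hmem u hu.1 (this.2 hu.2)⟩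
    · exfalso
      have hpos : ∀ q ∈ (TameEnds.boxChart ψ c w hw).source, 0 < ψ q 0 := fun q hq => by
        have := (abs_lt.1 ((mem_boxChart_source.1 hq).2 0)).1
        linarith
      have hi : (𝓡∂ m).IsInteriorPoint p := by
        refine hreg.isInteriorPoint hp ?_
        have ht : (TameEnds.boxChart ψ c w hw).target = cube m 1 := by
          refine subset_antisymm inter_subset_right fun u hu => hmem u hu ?_
          change 0 ≤ e u 0
          rw [hee]
          have := (abs_lt.1 (hu 0)).1
          nlinarith
        rw [ht]
        exact (isOpen_cube 1).mem_nhds hp.2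
      exact ((𝓡∂ m).isInteriorPoint_iff_not_isBoundaryPoint p).1 hi hpb

/-- Every point of `M` is the center of a normalized chart with relatively compact domain. -/
theorem exists_tight_normalized_chart (p : M) :
    ∃ κ : PartialEquiv M (EuclideanSpace ℝ (Fin m)), IsTight κ ∧ IsNormalizedChart κ ∧
      p ∈ κ.source ∧ κ p = 0 := by
  have h := isHalfChart_extChartAt (m := m) p
  set ψ := extChartAt (𝓡∂ m) p with hψ
  obtain ⟨O, hO, hOt⟩ := h.target_eq
  have hp : p ∈ ψ.source := mem_extChartAt_source p
  have hx : ψ p ∈ O ∩ halfSpace m := hOt ▸ ψ.map_source hp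
  have hx0 : 0 ≤ ψ p 0 := hx.2
  obtain ⟨ε, hε, hball⟩ := Metric.isOpen_iff.1 hO _ hx.1
  -- half side length of a cube around `ψ p` contained in `O`, and not crossing the boundary
  obtain ⟨r, hr, hrε, hr0⟩ : ∃ r : ℝ, 0 < r ∧ √m * r < ε ∧ (ψ p 0 = 0 ∨ r ≤ ψ p 0) := by
    have hs : 0 < √m + 1 := by positivity
    have h1 : √m * (ε / (√m + 1)) < ε := by
      rw [mul_div_assoc', div_lt_iff₀ hs]; nlinarith [Real.sqrt_nonneg m]
    rcases hx0.eq_or_lt with h0 | h0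
    · exact ⟨ε / (√m + 1), by positivity, h1, Or.inl h0.symm⟩
    · exact ⟨min (ε / (√m + 1)) (ψ p 0), by positivity,
        lt_of_le_of_lt (by gcongr; exact min_le_left _ _) h1, Or.inr (min_le_right _ _)⟩
  have hw : ∀ i, 0 < (WithLp.toLp 2 fun _ => r : EuclideanSpace ℝ (Fin m)) i := fun _ => hr
  obtain ⟨h1, h2⟩ := h.boxChart (c := ψ p) (hw := hw) hr0 fun x hxH hxb => by
    rw [hOt]
    refine ⟨hball ?_, hxH⟩
    rw [Metric.mem_ball, EuclideanSpace.dist_eq]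
    refine lt_of_le_of_lt ?_ hrε
    rw [← Real.sqrt_sq hr.le, ← Real.sqrt_mul (Nat.cast_nonneg m)]
    apply Real.sqrt_le_sqrt
    calc ∑ i, dist (x i) (ψ p i) ^ 2 ≤ ∑ _i : Fin m, r ^ 2 := by
          gcongr with i
          exact hxb i
      _ = m * r ^ 2 := by simp
  refine ⟨_, h1, h2, mem_boxChart_source.2 ⟨hp, fun i => by simpa using hr⟩, ?_⟩
  ext i
  simp [boxChart_apply]

end Box

/-! ### Compact sets meet only a bounded part of an end -/

section Proper

variable {m : ℕ} [NeZero m] {M : Type*} [TopologicalSpace M]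
  [ChartedSpace (EuclideanHalfSpace m) M] [IsManifold (𝓡∂ m) ∞ M]
  {g : Metric m M} {V : Set M} {d : ℕ} {α : ℝ} {B : Set (EuclideanSpace ℝ (Fin d))}
  {Φ : PartialEquiv M (WithLp 2 (ℝ × EuclideanSpace ℝ (Fin d)))}

theorem IsTameEnd.exists_apply_eq (h : IsTameEnd g V α B Φ) {p : M} (hp : p ∈ V) :
    ∃ t : ℝ, 1 < t ∧ ∃ y ∈ B, Φ p = WithLp.toLp 2 (t, t ^ α • y) := by
  have : Φ p ∈ funnel α B := by
    rw [← h.isometry.target_eq]; exact Φ.map_source (h.isometry.source_eq ▸ hp)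
  exact this

theorem IsTameEnd.symm_mem (h : IsTameEnd g V α B Φ) {t : ℝ} (ht : 1 < t)
    {y : EuclideanSpace ℝ (Fin d)} (hy : y ∈ B) : Φ.symm (WithLp.toLp 2 (t, t ^ α • y)) ∈ V := by
  have : WithLp.toLp 2 (t, t ^ α • y) ∈ Φ.target := by
    rw [h.isometry.target_eq]; exact ⟨t, ht, y, hy, rfl⟩
  rw [← h.isometry.source_eq]
  exact Φ.map_target this

theorem IsTameEnd.apply_symm (h : IsTameEnd g V α B Φ) {t : ℝ} (ht : 1 < t)
    {y : EuclideanSpace ℝ (Fin d)} (hy : y ∈ B) :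
    Φ (Φ.symm (WithLp.toLp 2 (t, t ^ α • y))) = WithLp.toLp 2 (t, t ^ α • y) := by
  apply Φ.right_inv
  rw [h.isometry.target_eq]; exact ⟨t, ht, y, hy, rfl⟩

theorem IsTameEnd.isCompact_slab (h : IsTameEnd g V α B Φ) {a b : ℝ} (ha : 1 < a) :
    IsCompact {p ∈ V | (Φ p).fst ∈ Icc a b} := by
  set f : ℝ × EuclideanSpace ℝ (Fin d) → WithLp 2 (ℝ × EuclideanSpace ℝ (Fin d)) :=
    fun z => WithLp.toLp 2 (z.1, z.1 ^ α • z.2)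
  have hf : ContinuousOn f (Icc a b ×ˢ B) := by
    have : ContinuousOn (fun z : ℝ × EuclideanSpace ℝ (Fin d) => z.1 ^ α) (Icc a b ×ˢ B) :=
      continuousOn_fst.rpow_const fun z hz => Or.inl (by linarith [hz.1.1])
    exact (WithLp.prod_continuous_toLp 2 _ _).comp_continuousOn
      (continuousOn_fst.prodMk (this.smul continuousOn_snd))
  have hfF : f '' (Icc a b ×ˢ B) ⊆ funnel α B := by
    rintro _ ⟨z, hz, rfl⟩
    exact ⟨z.1, lt_of_lt_of_le ha hz.1.1, z.2, hz.2, rfl⟩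
  have hK := ((isCompact_Icc.prod h.isCompact_base).image_of_continuousOn hf).image_of_continuousOn
    (h.isometry.contMDiffOn_symm.continuousOn.mono hfF)
  convert hK using 1
  ext p
  constructor
  · rintro ⟨hp, hpt⟩
    obtain ⟨t, ht, y, hy, e⟩ := h.exists_apply_eq hp
    rw [e] at hpt
    refine ⟨_, ⟨(t, y), ⟨hpt, hy⟩, rfl⟩, ?_⟩
    change Φ.symm (WithLp.toLp 2 (t, t ^ α • y)) = p
    rw [← e]
    exact Φ.left_inv (h.isometry.source_eq ▸ hp)
  · rintro ⟨_, ⟨⟨t, y⟩, ⟨ht, hy⟩, rfl⟩, rfl⟩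
    have ht1 : 1 < t := lt_of_lt_of_le ha ht.1
    exact ⟨h.symm_mem ht1 hy, by rw [h.apply_symm ht1 hy]; exact ht⟩

/-- The height `t` is bounded on the part of an end near any point of `M`, even a point outside the
end. Indeed, `t` changes along a curve by at most the length of the curve, so that a short segment
in a chart that starts at a great height stays in a slab `a ≤ t ≤ b` as long as it runs in the end;
as slabs are compact, it cannot leave the end. Hence, if the end reaches a great height near the
point, then a whole neighborhood lies in a slab. -/
theorem IsTameEnd.exists_nhds_fst_le [T2Space M] (h : IsTameEnd g V α B Φ) (p : M) :
    ∃ N ∈ 𝓝 p, ∃ R : ℝ, ∀ q ∈ N ∩ V, (Φ q).fst ≤ R := by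
  have he := isHalfChart_extChartAt (m := m) p
  set e := extChartAt (𝓡∂ m) p
  obtain ⟨O, hO, hOt⟩ := he.target_eq
  have hps : p ∈ e.source := mem_extChartAt_source p
  have hpt : e p ∈ e.target := e.map_source hps
  set P := pushforwardMetric g e
  have hPc : ContinuousOn P e.target := (he.contDiffOn_pushforwardMetric g).continuousOn
  have hPn : ContinuousOn (fun x => ‖P x‖) e.target :=
    (continuous_norm (E := EuclideanSpace ℝ (Fin m) →L[ℝ] EuclideanSpace ℝ (Fin m) →L[ℝ] ℝ)
      ).comp_continuousOn hPc
  set Λ : ℝ := ‖P (e p)‖ + 1 with hΛ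
  have hΛ1 : 1 ≤ Λ := by rw [hΛ]; linarith [norm_nonneg (P (e p))]
  have hev : ∀ᶠ x in 𝓝[e.target] (e p), ‖P x‖ < Λ :=
    Tendsto.eventually_lt_const (by rw [hΛ]; linarith) (hPn (e p) hpt)
  rw [hOt, inter_comm, nhdsWithin_inter_of_mem' (mem_nhdsWithin_of_mem_nhds
    (hO.mem_nhds (hOt ▸ hpt : e p ∈ O ∩ halfSpace m).1))] at hev
  obtain ⟨r₁, hr₁, hball₁⟩ := Metric.mem_nhdsWithin_iff.1 hev
  obtain ⟨r₂, hr₂, hball₂⟩ := Metric.isOpen_iff.1 hO (e p)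
    (hOt ▸ hpt : e p ∈ O ∩ halfSpace m).1
  set r := min r₁ r₂
  have hr : 0 < r := lt_min hr₁ hr₂
  set C : Set (EuclideanSpace ℝ (Fin m)) := Metric.ball (e p) r ∩ halfSpace m
  have hCconv : Convex ℝ C := (convex_ball _ _).inter EuclideanHalfSpace.convex
  have hCt : C ⊆ e.target := fun x hx => by
    rw [hOt]; exact ⟨hball₂ (Metric.ball_subset_ball (min_le_right _ _) hx.1), hx.2⟩
  have hCP : ∀ x ∈ C, ∀ ξ, P x ξ ξ ≤ (Λ * ‖ξ‖) ^ 2 := fun x hx ξ => by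
    have h1 : ‖P x‖ < Λ := hball₁ ⟨Metric.ball_subset_ball (min_le_left _ _) hx.1, hx.2⟩
    calc P x ξ ξ ≤ ‖P x ξ ξ‖ := le_abs_self _
      _ ≤ ‖P x‖ * ‖ξ‖ * ‖ξ‖ := (P x).le_opNorm₂ ξ ξ
      _ ≤ Λ ^ 2 * ‖ξ‖ * ‖ξ‖ := by gcongr; nlinarith
      _ = _ := by ring
  -- `K` exceeds the length of every segment in the coordinate ball of radius `r`
  set K : ℝ := Λ * (2 * r) + 1
  set N : Set M := e.source ∩ e ⁻¹' Metric.ball (e p) r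
  have hN : N ∈ 𝓝 p := (he.contMDiffOn.continuousOn.isOpen_inter_preimage he.isOpen_source
    Metric.isOpen_ball).mem_nhds ⟨hps, Metric.mem_ball_self hr⟩
  have hNC : ∀ q ∈ N, e q ∈ C := fun q hq =>
    ⟨hq.2, he.target_subset (e.map_source hq.1)⟩
  have key : ∀ q₀ ∈ N, q₀ ∈ V → 1 + K < (Φ q₀).fst → ∀ q₁ ∈ N,
      q₁ ∈ V ∧ |(Φ q₁).fst - (Φ q₀).fst| ≤ K := by
    intro q₀ hq₀ hq₀V hq₀K q₁ hq₁
    set τ := (Φ q₀).fst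
    set γ : ℝ → EuclideanSpace ℝ (Fin m) := fun σ => e q₀ + σ • (e q₁ - e q₀) with hγ
    have hγC : ∀ σ ∈ Icc (0 : ℝ) 1, γ σ ∈ C := fun σ hσ =>
      hCconv.add_smul_sub_mem (hNC _ hq₀) (hNC _ hq₁) hσ
    have hγd (σ : ℝ) : HasDerivAt γ (e q₁ - e q₀) σ := by
      have := ((hasDerivAt_id σ).smul_const (e q₁ - e q₀)).const_add (e q₀)
      rwa [one_smul] at this
    have hγc : Continuous γ := by fun_prop
    set δ : ℝ → M := fun σ => e.symm (γ σ) with hδ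
    have hδc : ContinuousOn δ (Icc 0 1) :=
      he.contMDiffOn_symm.continuousOn.comp hγc.continuousOn fun σ hσ => hCt (hγC σ hσ)
    have hlen : ‖e q₁ - e q₀‖ < 2 * r := by
      have h1 := Metric.mem_ball.1 hq₁.2
      have h0 := Metric.mem_ball.1 hq₀.2
      rw [← dist_eq_norm]
      linarith [dist_triangle_right (e q₁) (e q₀) (e p)]
    -- continuous induction along the segment `δ` from `q₀` to `q₁`
    set s : Set ℝ := {σ | δ σ ∈ V ∧ |(Φ (δ σ)).fst - τ| ≤ K * σ} with hs
    have hcV : ContinuousOn (fun q => (Φ q).fst) V :=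
      (WithLp.continuous_fst 2 ℝ _).comp_continuousOn h.isometry.contMDiffOn.continuousOn
    have hK0 : 0 ≤ K := by positivity
    have hsclosed : IsClosed (s ∩ Icc 0 1) := by
      have hA := (h.isCompact_slab (a := τ - K) (b := τ + K) (by linarith)).isClosed
      have hA' := hδc.preimage_isClosed_of_isClosed isClosed_Icc hA
      have := hA'.isClosed_le (f := fun σ => |(Φ (δ σ)).fst - τ|) (g := fun σ => K * σ)
        ((hcV.comp (hδc.mono inter_subset_left) fun σ hσ => hσ.2.1).sub continuousOn_const).abs
        (by fun_prop)
      convert this using 1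
      ext σ
      constructor
      · rintro ⟨⟨h1, h2⟩, hσ⟩
        have h3 := abs_le.1 (h2.trans (mul_le_of_le_one_right hK0 hσ.2))
        exact ⟨⟨hσ, h1, by linarith [h3.1], by linarith [h3.2]⟩, h2⟩
      · rintro ⟨⟨hσ, h1, -⟩, h2⟩
        exact ⟨⟨h1, h2⟩, hσ⟩
    have h0s : (0 : ℝ) ∈ s := by
      have : δ 0 = q₀ := by simp [hδ, hγ, e.left_inv hq₀.1]
      refine ⟨this ▸ hq₀V, ?_⟩
      rw [this]; simp [τ]
    have hstep : ∀ σ ∈ s ∩ Ico 0 1, s ∈ 𝓝[>] σ := by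
      rintro σ ⟨⟨hσV, hσK⟩, hσ⟩
      have hI : Icc (0 : ℝ) 1 ∈ 𝓝[>] σ :=
        mem_of_superset (Ioc_mem_nhdsGT hσ.2) fun y hy => ⟨hσ.1.trans hy.1.le, hy.2⟩
      have hσI : σ ∈ Icc (0 : ℝ) 1 := ⟨hσ.1, hσ.2.le⟩
      have hσt := hCt (hγC σ hσI)
      have hdiff := h.isometry.differentiableWithinAt_comp_symm h.isOpen he.toIsRegularChart
        hσt hσV
      have hder := (hdiff.hasFDerivWithinAt.comp_hasDerivWithinAt σ
        ((hγd σ).hasDerivWithinAt (s := Icc 0 1)) fun y hy => hCt (hγC y hy))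
      set D := fderivWithin ℝ (Φ ∘ e.symm) e.target (γ σ) (e q₁ - e q₀) with hD
      have hder' : HasDerivWithinAt (fun y => (Φ (δ y)).fst) D.fst (Icc 0 1) σ :=
        (WithLp.fstL 2 ℝ ℝ (EuclideanSpace ℝ (Fin d))).hasFDerivAt.comp_hasDerivWithinAt σ hder
      have hDK : ‖D.fst‖ < K := by
        have h1 : ‖D‖ ^ 2 ≤ (Λ * ‖e q₁ - e q₀‖) ^ 2 := by
          rw [← real_inner_self_eq_norm_sq, hD, ← h.isometry.pushforwardMetric_apply h.isOpen
            he.toIsRegularChart hσt hσV]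
          exact hCP _ (hγC σ hσI) _
        have h2 : ‖D‖ ≤ Λ * ‖e q₁ - e q₀‖ := abs_le_of_sq_le_sq' h1 (by positivity) |>.2
        have h3 : Λ * ‖e q₁ - e q₀‖ ≤ Λ * (2 * r) := by gcongr
        have h4 : ‖D.fst‖ ≤ ‖D‖ := WithLp.norm_fst_le _ D
        linarith
      have hslope := (hder'.mono_of_mem_nhdsWithin hI).limsup_norm_slope_le hDK
      have hVev : ∀ᶠ y in 𝓝[>] σ, δ y ∈ V :=
        ((hδc σ hσI).mono_of_mem_nhdsWithin hI).eventually_mem (h.isOpen.mem_nhds hσV)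
      filter_upwards [hslope, hVev, self_mem_nhdsWithin] with y hy hyV hyσ
      refine ⟨hyV, ?_⟩
      have hpos : 0 < y - σ := sub_pos.2 hyσ
      rw [Real.norm_of_nonneg hpos.le, inv_mul_lt_iff₀ hpos, Real.norm_eq_abs] at hy
      have := abs_sub_le (Φ (δ y)).fst (Φ (δ σ)).fst τ
      nlinarith
    have h1s : (1 : ℝ) ∈ s := hsclosed.Icc_subset_of_forall_mem_nhdsWithin h0s hstep
      ⟨zero_le_one, le_rfl⟩
    have h1 : δ 1 = q₁ := by simp [hδ, hγ, e.left_inv hq₁.1]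
    rw [hs, mem_ofPred_eq, h1, mul_one] at h1s
    exact h1s
  refine ⟨N, hN, ?_⟩
  by_cases hex : ∃ q₀ ∈ N, q₀ ∈ V ∧ 1 + K < (Φ q₀).fst
  · obtain ⟨q₀, hq₀, hq₀V, hq₀K⟩ := hex
    refine ⟨(Φ q₀).fst + K, fun q hq => ?_⟩
    have := (abs_le.1 (key q₀ hq₀ hq₀V hq₀K q hq.1).2).2
    linarith
  · push Not at hex
    exact ⟨1 + K, fun q hq => hex q hq.1 hq.2⟩

theorem IsTameEnd.exists_fst_le_of_isCompact [T2Space M] (h : IsTameEnd g V α B Φ) {L : Set M}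
    (hL : IsCompact L) : ∃ R : ℝ, ∀ q ∈ L ∩ V, (Φ q).fst ≤ R := by
  refine hL.induction_on (p := fun L => ∃ R : ℝ, ∀ q ∈ L ∩ V, (Φ q).fst ≤ R) ⟨0, by simp⟩ ?_ ?_ ?_
  · rintro s t hst ⟨R, hR⟩
    exact ⟨R, fun q hq => hR q ⟨hst hq.1, hq.2⟩⟩
  · rintro s t ⟨R, hR⟩ ⟨R', hR'⟩
    refine ⟨max R R', ?_⟩
    rintro q ⟨hq | hq, hqV⟩
    · exact (hR q ⟨hq, hqV⟩).trans (le_max_left _ _)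
    · exact (hR' q ⟨hq, hqV⟩).trans (le_max_right _ _)
  · intro p _
    obtain ⟨N, hN, hR⟩ := h.exists_nhds_fst_le p
    exact ⟨N, mem_nhdsWithin_of_mem_nhds hN, hR⟩

end Proper

/-! ### Funnel coordinates -/

section Linear

/-- The index of the last coordinate of `ℝ^m`, which serves as the height of the funnel. -/
def lastIdx (m : ℕ) [NeZero m] : Fin m := ⟨m - 1, by have := NeZero.pos m; omega⟩

/-- The map `ℝ^m → ℝ^d` that keeps the first `m - 1` coordinates and fills up with zeros. -/
def toBase (m d : ℕ) : EuclideanSpace ℝ (Fin m) →L[ℝ] EuclideanSpace ℝ (Fin d) :=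
  LinearMap.toContinuousLinearMap
    { toFun := fun x => WithLp.toLp 2 fun i =>
        if h : i.val < m - 1 then x ⟨i.val, by omega⟩ else 0
      map_add' := fun x y => by ext i; by_cases h : i.val < m - 1 <;> simp [h]
      map_smul' := fun a x => by ext i; by_cases h : i.val < m - 1 <;> simp [h] }

/-- The map `ℝ^d → ℝ^m` that keeps the first `m - 1` coordinates and fills up with a zero. -/
def fromBase (m d : ℕ) (hmd : m - 1 ≤ d) :
    EuclideanSpace ℝ (Fin d) →L[ℝ] EuclideanSpace ℝ (Fin m) :=
  LinearMap.toContinuousLinearMap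
    { toFun := fun v => WithLp.toLp 2 fun j =>
        if h : j.val < m - 1 then v ⟨j.val, by omega⟩ else 0
      map_add' := fun x y => by ext i; by_cases h : i.val < m - 1 <;> simp [h]
      map_smul' := fun a x => by ext i; by_cases h : i.val < m - 1 <;> simp [h] }

/-- The unit vector in the direction of the height. -/
def lastVec (m : ℕ) [NeZero m] : EuclideanSpace ℝ (Fin m) :=
  EuclideanSpace.single (lastIdx m) 1

variable {m d : ℕ}

theorem toBase_apply (x : EuclideanSpace ℝ (Fin m)) (i : Fin d) :
    toBase m d x i = if h : i.val < m - 1 then x ⟨i.val, by omega⟩ else 0 := rfl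

theorem fromBase_apply (hmd : m - 1 ≤ d) (v : EuclideanSpace ℝ (Fin d)) (j : Fin m) :
    fromBase m d hmd v j = if h : j.val < m - 1 then v ⟨j.val, by omega⟩ else 0 := rfl

theorem toBase_fromBase (hmd : m - 1 ≤ d) {v : EuclideanSpace ℝ (Fin d)}
    (hv : ∀ i : Fin d, m - 1 ≤ i.val → v i = 0) : toBase m d (fromBase m d hmd v) = v := by
  ext i
  rw [toBase_apply]
  split_ifs with h
  · rw [fromBase_apply, dif_pos h]
  · exact (hv i (not_lt.1 h)).symm

variable [NeZero m]

theorem lastIdx_eq_iff {j : Fin m} : j = lastIdx m ↔ ¬ j.val < m - 1 := by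
  have := j.isLt
  rw [Fin.ext_iff, lastIdx]
  simp only
  omega

theorem lastVec_lastIdx : lastVec m (lastIdx m) = 1 := by simp [lastVec]

theorem lastVec_of_lt {j : Fin m} (h : j.val < m - 1) : lastVec m j = 0 := by
  have : j ≠ lastIdx m := fun e => lastIdx_eq_iff.1 e h
  simp [lastVec, this]

theorem toBase_lastVec : toBase m d (lastVec m) = 0 := by
  ext i
  rw [toBase_apply]
  split_ifs with h
  · exact lastVec_of_lt (j := ⟨i.val, by omega⟩) h
  · rfl

theorem fromBase_lastIdx (hmd : m - 1 ≤ d) (v : EuclideanSpace ℝ (Fin d)) :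
    fromBase m d hmd v (lastIdx m) = 0 := by
  rw [fromBase_apply, dif_neg (lastIdx_eq_iff.1 rfl)]

theorem fromBase_toBase_add (hmd : m - 1 ≤ d) (x : EuclideanSpace ℝ (Fin m)) :
    fromBase m d hmd (toBase m d x) + x (lastIdx m) • lastVec m = x := by
  ext j
  rw [PiLp.add_apply, PiLp.smul_apply]
  by_cases h : j.val < m - 1
  · rw [lastVec_of_lt h, fromBase_apply, dif_pos h, toBase_apply, dif_pos h]
    simp
  · obtain rfl := lastIdx_eq_iff.2 h
    rw [lastVec_lastIdx, fromBase_lastIdx]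
    simp

end Linear

section FunnelMap

variable {m : ℕ} [NeZero m] {d : ℕ}

/-- The parametrization `x ↦ (t, t ^ α • φ⁻¹(x'))`, where `x = (x', t)`, of a funnel by means of a
chart `φ` of its base. -/
def funnelMap (α : ℝ) (φ : OpenPartialHomeomorph (EuclideanSpace ℝ (Fin d))
    (EuclideanSpace ℝ (Fin d))) (x : EuclideanSpace ℝ (Fin m)) :
    WithLp 2 (ℝ × EuclideanSpace ℝ (Fin d)) :=
  WithLp.toLp 2 (x (lastIdx m), x (lastIdx m) ^ α • φ.symm (toBase m d x))

/-- The left inverse `(t, w) ↦ (φ(t ^ (-α) • w)', t)` of `funnelMap α φ`, defined on an open subset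
of the ambient space of the funnel. -/
def funnelInv (hmd : m - 1 ≤ d) (α : ℝ) (φ : OpenPartialHomeomorph (EuclideanSpace ℝ (Fin d))
    (EuclideanSpace ℝ (Fin d))) (z : WithLp 2 (ℝ × EuclideanSpace ℝ (Fin d))) :
    EuclideanSpace ℝ (Fin m) :=
  fromBase m d hmd (φ (z.fst ^ (-α) • z.snd)) + z.fst • lastVec m

/-- The domain of smoothness of `funnelMap α φ`. -/
def funnelMapDomain (m : ℕ) [NeZero m] (φ : OpenPartialHomeomorph (EuclideanSpace ℝ (Fin d))
    (EuclideanSpace ℝ (Fin d))) : Set (EuclideanSpace ℝ (Fin m)) :=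
  {x | 0 < x (lastIdx m) ∧ toBase m d x ∈ φ.target}

/-- The domain of smoothness of `funnelInv hmd α φ`. -/
def funnelInvDomain (α : ℝ) (φ : OpenPartialHomeomorph (EuclideanSpace ℝ (Fin d))
    (EuclideanSpace ℝ (Fin d))) : Set (WithLp 2 (ℝ × EuclideanSpace ℝ (Fin d))) :=
  {z | 0 < z.fst ∧ z.fst ^ (-α) • z.snd ∈ φ.source}

variable {α : ℝ} {φ : OpenPartialHomeomorph (EuclideanSpace ℝ (Fin d))
  (EuclideanSpace ℝ (Fin d))}

theorem rpow_neg_smul_rpow_smul {t : ℝ} (ht : 0 < t) (y : EuclideanSpace ℝ (Fin d)) :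
    t ^ (-α) • t ^ α • y = y := by
  rw [smul_smul, ← Real.rpow_add ht, neg_add_cancel, Real.rpow_zero, one_smul]

theorem isOpen_funnelMapDomain : IsOpen (funnelMapDomain m φ) :=
  IsOpen.and (isOpen_lt (by fun_prop) (by fun_prop))
    (φ.open_target.preimage (toBase m d).continuous)

theorem contDiffOn_rpow_neg_smul : ContDiffOn ℝ ∞
    (fun z : WithLp 2 (ℝ × EuclideanSpace ℝ (Fin d)) => z.fst ^ (-α) • z.snd)
    {z | 0 < z.fst} := by
  have h1 : ContDiff ℝ ∞ (fun z : WithLp 2 (ℝ × EuclideanSpace ℝ (Fin d)) => z.fst) :=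
    (WithLp.fstL 2 ℝ ℝ (EuclideanSpace ℝ (Fin d))).contDiff
  have h2 : ContDiff ℝ ∞ (fun z : WithLp 2 (ℝ × EuclideanSpace ℝ (Fin d)) => z.snd) :=
    (WithLp.sndL 2 ℝ ℝ (EuclideanSpace ℝ (Fin d))).contDiff
  exact (h1.contDiffOn.rpow_const_of_ne fun z hz => ne_of_gt hz).smul h2.contDiffOn

theorem isOpen_funnelInvDomain : IsOpen (funnelInvDomain α φ) :=
  contDiffOn_rpow_neg_smul.continuousOn.isOpen_inter_preimage
    (isOpen_lt continuous_const (WithLp.continuous_fst 2 ℝ _)) φ.open_source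

theorem contDiffOn_funnelMap (hφ : ContDiffOn ℝ ∞ φ.symm φ.target) :
    ContDiffOn ℝ ∞ (funnelMap α φ) (funnelMapDomain m φ) := by
  have h1 : ContDiff ℝ ∞ (fun x : EuclideanSpace ℝ (Fin m) => x (lastIdx m)) := by fun_prop
  have h2 : ContDiffOn ℝ ∞ (fun x : EuclideanSpace ℝ (Fin m) => φ.symm (toBase m d x))
      (funnelMapDomain m φ) := hφ.comp (toBase m d).contDiff.contDiffOn fun x hx => hx.2
  exact (WithLp.prodContinuousLinearEquiv 2 ℝ ℝ (EuclideanSpace ℝ (Fin d))).symm.contDiff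
    |>.comp_contDiffOn (h1.contDiffOn.prodMk
      ((h1.contDiffOn.rpow_const_of_ne fun z hz => ne_of_gt hz.1).smul h2))

theorem contDiffOn_funnelInv (hmd : m - 1 ≤ d) (hφ : ContDiffOn ℝ ∞ φ φ.source) :
    ContDiffOn ℝ ∞ (funnelInv hmd α φ) (funnelInvDomain α φ) := by
  have h1 : ContDiff ℝ ∞ (fun z : WithLp 2 (ℝ × EuclideanSpace ℝ (Fin d)) => z.fst) :=
    (WithLp.fstL 2 ℝ ℝ (EuclideanSpace ℝ (Fin d))).contDiff
  have h2 := hφ.comp (contDiffOn_rpow_neg_smul.mono fun z (hz : z ∈ funnelInvDomain α φ) => hz.1)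
    fun z hz => hz.2
  exact ((fromBase m d hmd).contDiff.comp_contDiffOn h2).add (h1.smul contDiff_const).contDiffOn

theorem funnelMap_mem_funnelInvDomain {x : EuclideanSpace ℝ (Fin m)}
    (hx : x ∈ funnelMapDomain m φ) : funnelMap α φ x ∈ funnelInvDomain α φ := by
  refine ⟨hx.1, ?_⟩
  change x (lastIdx m) ^ (-α) • x (lastIdx m) ^ α • φ.symm (toBase m d x) ∈ φ.source
  rw [rpow_neg_smul_rpow_smul hx.1]
  exact φ.map_target hx.2

theorem funnelInv_funnelMap (hmd : m - 1 ≤ d) {x : EuclideanSpace ℝ (Fin m)}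
    (hx : x ∈ funnelMapDomain m φ) : funnelInv hmd α φ (funnelMap α φ x) = x := by
  change fromBase m d hmd (φ (x (lastIdx m) ^ (-α) • x (lastIdx m) ^ α • φ.symm (toBase m d x)))
    + x (lastIdx m) • lastVec m = x
  rw [rpow_neg_smul_rpow_smul hx.1, φ.right_inv hx.2, fromBase_toBase_add]

theorem funnelInv_toLp (hmd : m - 1 ≤ d) {t : ℝ} (ht : 0 < t) (y : EuclideanSpace ℝ (Fin d)) :
    funnelInv hmd α φ (WithLp.toLp 2 (t, t ^ α • y)) =
      fromBase m d hmd (φ y) + t • lastVec m := by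
  change fromBase m d hmd (φ (t ^ (-α) • t ^ α • y)) + t • lastVec m = _
  rw [rpow_neg_smul_rpow_smul ht]

end FunnelMap

/-! ### The charts of an end -/

section EndChart

variable {m : ℕ} [NeZero m] {d : ℕ} {α : ℝ} {B : Set (EuclideanSpace ℝ (Fin d))}

/-- `φ` is a smooth chart of the ambient space that straightens the base `B` of a funnel, as in
`IsSubmanifold`. -/
structure IsBaseChart (m : ℕ) (B : Set (EuclideanSpace ℝ (Fin d)))
    (φ : OpenPartialHomeomorph (EuclideanSpace ℝ (Fin d)) (EuclideanSpace ℝ (Fin d))) :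
    Prop where
  contDiffOn : ContDiffOn ℝ ∞ φ φ.source
  contDiffOn_symm : ContDiffOn ℝ ∞ φ.symm φ.target
  image_eq : φ '' (φ.source ∩ B) =
    φ.target ∩ {x | (∀ i, m - 1 ≤ i.val → x i = 0) ∧ (∀ i, i.val = 0 → 0 ≤ x i)}

variable {φ : OpenPartialHomeomorph (EuclideanSpace ℝ (Fin d)) (EuclideanSpace ℝ (Fin d))}

theorem IsBaseChart.symm_toBase_mem (hφ : IsBaseChart m B φ) {x : EuclideanSpace ℝ (Fin m)}
    (hx : toBase m d x ∈ φ.target) (hx0 : x ∈ halfSpace m) : φ.symm (toBase m d x) ∈ B := by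
  have : toBase m d x ∈ φ '' (φ.source ∩ B) := by
    rw [hφ.image_eq]
    refine ⟨hx, fun i hi => ?_, fun i hi => ?_⟩
    · rw [toBase_apply, dif_neg (not_lt.2 hi)]
    · rw [toBase_apply]
      split_ifs with h
      · have : (⟨i.val, by omega⟩ : Fin m) = 0 := Fin.ext (by simp [hi])
        rw [this]; exact hx0
      · exact le_rfl
  obtain ⟨y, ⟨hys, hyB⟩, hy⟩ := this
  rw [← hy, φ.left_inv hys]
  exact hyB

theorem IsBaseChart.apply_mem {m : ℕ} (hφ : IsBaseChart m B φ) {y : EuclideanSpace ℝ (Fin d)}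
    (hy : y ∈ φ.source) (hyB : y ∈ B) :
    (∀ i, m - 1 ≤ i.val → φ y i = 0) ∧ (∀ i, i.val = 0 → 0 ≤ φ y i) := by
  have : φ y ∈ φ '' (φ.source ∩ B) := mem_image_of_mem _ ⟨hy, hyB⟩
  rw [hφ.image_eq] at this
  exact this.2

theorem IsBaseChart.toBase_fromBase_add (hφ : IsBaseChart m B φ) (hmd : m - 1 ≤ d)
    {y : EuclideanSpace ℝ (Fin d)} (hy : y ∈ φ.source) (hyB : y ∈ B) (t : ℝ) :
    toBase m d (fromBase m d hmd (φ y) + t • lastVec m) = φ y := by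
  rw [map_add, map_smul, toBase_lastVec, smul_zero, add_zero,
    toBase_fromBase hmd (hφ.apply_mem hy hyB).1]

theorem fromBase_add_lastIdx (hmd : m - 1 ≤ d) (v : EuclideanSpace ℝ (Fin d)) (t : ℝ) :
    (fromBase m d hmd v + t • lastVec m) (lastIdx m) = t := by
  rw [PiLp.add_apply, PiLp.smul_apply, fromBase_lastIdx, lastVec_lastIdx]
  simp

theorem IsBaseChart.fromBase_add_mem_halfSpace (hφ : IsBaseChart m B φ) (hmd : m - 1 ≤ d)
    {y : EuclideanSpace ℝ (Fin d)} (hy : y ∈ φ.source) (hyB : y ∈ B) {t : ℝ} (ht : 0 ≤ t) :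
    fromBase m d hmd (φ y) + t • lastVec m ∈ halfSpace m := by
  change 0 ≤ (fromBase m d hmd (φ y) + t • lastVec m) 0
  by_cases h : (0 : Fin m).val < m - 1
  · rw [PiLp.add_apply, PiLp.smul_apply, lastVec_of_lt h, fromBase_apply, dif_pos h, smul_zero,
      add_zero]
    exact (hφ.apply_mem hy hyB).2 _ (by simp)
  · rw [lastIdx_eq_iff.2 h, fromBase_add_lastIdx]
    exact ht

variable {M : Type*} [TopologicalSpace M]
  [ChartedSpace (EuclideanHalfSpace m) M] [IsManifold (𝓡∂ m) ∞ M]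
  {g : Metric m M} {V : Set M} {Φ : PartialEquiv M (WithLp 2 (ℝ × EuclideanSpace ℝ (Fin d)))}

theorem IsTameEnd.base_le (h : IsTameEnd g V α B Φ) : m - 1 ≤ d := h.isSubmanifold_base.1

theorem IsTameEnd.symm_funnelMap_mem (h : IsTameEnd g V α B Φ) (hφ : IsBaseChart m B φ)
    {x : EuclideanSpace ℝ (Fin m)} (hx : x ∈ halfSpace m) (ht : 1 < x (lastIdx m))
    (hxφ : toBase m d x ∈ φ.target) : Φ.symm (funnelMap α φ x) ∈ V :=
  h.symm_mem ht (hφ.symm_toBase_mem hxφ hx)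

theorem IsTameEnd.apply_symm_funnelMap (h : IsTameEnd g V α B Φ) (hφ : IsBaseChart m B φ)
    {x : EuclideanSpace ℝ (Fin m)} (hx : x ∈ halfSpace m) (ht : 1 < x (lastIdx m))
    (hxφ : toBase m d x ∈ φ.target) : Φ (Φ.symm (funnelMap α φ x)) = funnelMap α φ x :=
  h.apply_symm ht (hφ.symm_toBase_mem hxφ hx)

/-- The chart of the end `V` given by a chart `φ` of the base of its funnel; the last coordinate is
the height `t`. -/
def endChart (h : IsTameEnd g V α B Φ) (hφ : IsBaseChart m B φ) :
    PartialEquiv M (EuclideanSpace ℝ (Fin m)) where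
  toFun p := funnelInv h.base_le α φ (Φ p)
  invFun x := Φ.symm (funnelMap α φ x)
  source := V ∩ Φ ⁻¹' funnelInvDomain α φ
  target := {x | 1 < x (lastIdx m) ∧ toBase m d x ∈ φ.target} ∩ halfSpace m
  map_source' p := by
    rintro ⟨hp, hpφ⟩
    obtain ⟨t, ht, y, hy, e⟩ := h.exists_apply_eq hp
    have ht0 : 0 < t := one_pos.trans ht
    rw [mem_preimage, e] at hpφ
    have hyφ : t ^ (-α) • t ^ α • y ∈ φ.source := hpφ.2
    rw [rpow_neg_smul_rpow_smul ht0] at hyφ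
    rw [e, funnelInv_toLp _ ht0]
    refine ⟨⟨?_, ?_⟩, hφ.fromBase_add_mem_halfSpace _ hyφ hy ht0.le⟩
    · rwa [fromBase_add_lastIdx]
    · rw [hφ.toBase_fromBase_add _ hyφ hy]
      exact φ.map_source hyφ
  map_target' x := by
    rintro ⟨⟨hx1, hx2⟩, hx3⟩
    refine ⟨h.symm_funnelMap_mem hφ hx3 hx1 hx2, ?_⟩
    rw [mem_preimage, h.apply_symm_funnelMap hφ hx3 hx1 hx2]
    exact funnelMap_mem_funnelInvDomain ⟨one_pos.trans hx1, hx2⟩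
  left_inv' p := by
    rintro ⟨hp, hpφ⟩
    obtain ⟨t, ht, y, hy, e⟩ := h.exists_apply_eq hp
    have ht0 : 0 < t := one_pos.trans ht
    rw [mem_preimage, e] at hpφ
    have hyφ : t ^ (-α) • t ^ α • y ∈ φ.source := hpφ.2
    rw [rpow_neg_smul_rpow_smul ht0] at hyφ
    rw [e, funnelInv_toLp _ ht0, funnelMap, hφ.toBase_fromBase_add _ hyφ hy, fromBase_add_lastIdx,
      φ.left_inv hyφ, ← e]
    exact Φ.left_inv (h.isometry.source_eq ▸ hp)
  right_inv' x := by
    rintro ⟨⟨hx1, hx2⟩, hx3⟩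
    rw [h.apply_symm_funnelMap hφ hx3 hx1 hx2]
    exact funnelInv_funnelMap _ ⟨one_pos.trans hx1, hx2⟩

theorem isHalfChart_endChart (h : IsTameEnd g V α B Φ) (hφ : IsBaseChart m B φ) :
    IsHalfChart (endChart h hφ) := by
  have hΦc := h.isometry.contMDiffOn
  refine IsHalfChart.of_target_eq (hΦc.continuousOn.isOpen_inter_preimage h.isOpen
    isOpen_funnelInvDomain) ?_ ?_
    (O := {x | 1 < x (lastIdx m) ∧ toBase m d x ∈ φ.target})
    (IsOpen.and (isOpen_lt (by fun_prop) (by fun_prop))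
      (φ.open_target.preimage (toBase m d).continuous)) rfl
  · exact (contDiffOn_funnelInv h.base_le hφ.contDiffOn).contMDiffOn.comp
      (hΦc.mono inter_subset_left) fun p hp => hp.2
  · refine h.isometry.contMDiffOn_symm.comp
      ((contDiffOn_funnelMap hφ.contDiffOn_symm).mono fun x hx => ?_).contMDiffOn fun x hx => ?_
    · exact ⟨one_pos.trans hx.1.1, hx.1.2⟩
    · exact ⟨_, hx.1.1, _, hφ.symm_toBase_mem hx.1.2 hx.2, rfl⟩

end EndChart

/-! ### Uniform bounds on boxes adapted to the funnel -/

section FunnelBox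

variable {m : ℕ} [NeZero m] {d : ℕ}

/-- The box with center `c = (c', t₀)` and half side lengths `w` is adapted to the `α`-funnel: it
has height `ε` and its other half side lengths are `ε * t₀ ^ (-α)`, so that its image in the funnel
has size about `ε` in all directions. It lies above the base, and its projection to the base lies in
`K`. -/
structure IsFunnelBox (α ε : ℝ) (K : Set (EuclideanSpace ℝ (Fin d)))
    (c w : EuclideanSpace ℝ (Fin m)) : Prop where
  w_last : w (lastIdx m) = ε
  w_of_lt : ∀ j : Fin m, j.val < m - 1 → w j = ε * c (lastIdx m) ^ (-α)
  one_lt : 1 < c (lastIdx m) - ε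
  mem : ∀ x : EuclideanSpace ℝ (Fin m), (∀ i, |x i - c i| ≤ w i) → toBase m d x ∈ K

variable {α ε : ℝ} {K : Set (EuclideanSpace ℝ (Fin d))} {c w : EuclideanSpace ℝ (Fin m)}
  {φ : OpenPartialHomeomorph (EuclideanSpace ℝ (Fin d)) (EuclideanSpace ℝ (Fin d))}

theorem abs_boxMap_sub_le {m : ℕ} {c w : EuclideanSpace ℝ (Fin m)} (hw : ∀ i, 0 < w i)
    {u : EuclideanSpace ℝ (Fin m)} (hu : ∀ i, |u i| ≤ 1) (i : Fin m) :
    |boxMap c w hw u i - c i| ≤ w i := by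
  change |c i + w i * u i - c i| ≤ w i
  rw [add_sub_cancel_left, abs_mul, abs_of_pos (hw i)]
  exact mul_le_of_le_one_right (hw i).le (hu i)

theorem abs_apply_le_norm {m : ℕ} (u : EuclideanSpace ℝ (Fin m)) (i : Fin m) : |u i| ≤ ‖u‖ :=
  PiLp.norm_apply_le u i

namespace IsFunnelBox

theorem boxMap_lastIdx (hb : IsFunnelBox α ε K c w) (hw : ∀ i, 0 < w i)
    (u : EuclideanSpace ℝ (Fin m)) :
    boxMap c w hw u (lastIdx m) = c (lastIdx m) + ε * u (lastIdx m) := by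
  rw [← hb.w_last]; rfl

theorem toBase_boxMap (hb : IsFunnelBox α ε K c w) (hw : ∀ i, 0 < w i)
    (u : EuclideanSpace ℝ (Fin m)) :
    toBase m d (boxMap c w hw u) =
      toBase m d c + (ε * c (lastIdx m) ^ (-α)) • toBase m d u := by
  ext i
  rw [PiLp.add_apply, PiLp.smul_apply, toBase_apply, toBase_apply, toBase_apply]
  split_ifs with h
  · have hi : i.val < m := by omega
    change c ⟨i.val, hi⟩ + w ⟨i.val, hi⟩ * u ⟨i.val, hi⟩ = _
    rw [hb.w_of_lt ⟨i.val, hi⟩ h]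
    rfl
  · simp

theorem one_lt_of_mem (hb : IsFunnelBox α ε K c w) {x : EuclideanSpace ℝ (Fin m)}
    (hx : ∀ i, |x i - c i| ≤ w i) : 1 < x (lastIdx m) := by
  have h1 := (abs_le.1 (hx (lastIdx m))).1
  rw [hb.w_last] at h1
  linarith [hb.one_lt]

theorem mem_funnelMapDomain (hb : IsFunnelBox α ε K c w) (hK : K ⊆ φ.target)
    {x : EuclideanSpace ℝ (Fin m)} (hx : ∀ i, |x i - c i| ≤ w i) : x ∈ funnelMapDomain m φ :=
  ⟨one_pos.trans (hb.one_lt_of_mem hx), hK (hb.mem x hx)⟩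

end IsFunnelBox

theorem rpow_neg_bounds {t : ℝ} (ht : 1 ≤ t) (h0 : 0 ≤ α) (h1 : α ≤ 1) :
    0 < t ^ (-α) ∧ t ^ (-α) ≤ 1 ∧ t⁻¹ ≤ t ^ (-α) := by
  refine ⟨Real.rpow_pos_of_pos (by linarith) _,
    Real.rpow_le_one_of_one_le_of_nonpos ht (by linarith), ?_⟩
  rw [← Real.rpow_neg_one]
  exact Real.rpow_le_rpow_of_exponent_le ht (by linarith)

/-- The derivatives of positive order of the rescaled parametrizations of the funnel are bounded,
uniformly over all adapted boxes. -/
theorem exists_bound_funnelMap_boxMap (hφ : ContDiffOn ℝ ∞ φ.symm φ.target) (hKc : IsCompact K)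
    (hK : K ⊆ φ.target) (h0 : 0 ≤ α) (h1 : α ≤ 1) (hε : 0 < ε) (hε' : ε ≤ 1 / 2) (k : ℕ) :
    ∃ C : ℝ, ∀ (c w : EuclideanSpace ℝ (Fin m)) (hw : ∀ i, 0 < w i), IsFunnelBox α ε K c w →
      ∀ u : EuclideanSpace ℝ (Fin m), (∀ i, |u i| ≤ 1) → ∀ j, 1 ≤ j → j ≤ k →
        ‖iteratedFDeriv ℝ j (funnelMap α φ ∘ boxMap c w hw) u‖ ≤ C := by
  -- in the variables `s = (t - t₀) / t₀`, `v = x'`, `r = t₀ ^ (-α) * (t - t₀)` the parametrization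
  -- is `t₀ ^ α • Ψ`, up to a constant
  set Ψ : ℝ × EuclideanSpace ℝ (Fin d) × ℝ → WithLp 2 (ℝ × EuclideanSpace ℝ (Fin d)) :=
    fun z => WithLp.toLp 2 (z.2.2, (1 + z.1) ^ α • φ.symm z.2.1) with hΨ
  set O : Set (ℝ × EuclideanSpace ℝ (Fin d) × ℝ) := {z | 0 < 1 + z.1 ∧ z.2.1 ∈ φ.target}
  have hO : IsOpen O := IsOpen.and (isOpen_lt (by fun_prop) (by fun_prop))
    (φ.open_target.preimage (by fun_prop))
  have hΨO : ContDiffOn ℝ ∞ Ψ O := by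
    have e1 : ContDiff ℝ ∞ (fun z : ℝ × EuclideanSpace ℝ (Fin d) × ℝ => 1 + z.1) := by fun_prop
    have e2 : ContDiffOn ℝ ∞ (fun z : ℝ × EuclideanSpace ℝ (Fin d) × ℝ => φ.symm z.2.1) O :=
      hφ.comp (by fun_prop) fun z hz => hz.2
    have e3 : ContDiff ℝ ∞ (fun z : ℝ × EuclideanSpace ℝ (Fin d) × ℝ => z.2.2) := by fun_prop
    exact (WithLp.prodContinuousLinearEquiv 2 ℝ ℝ (EuclideanSpace ℝ (Fin d))).symm.contDiff
      |>.comp_contDiffOn (e3.contDiffOn.prodMk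
        ((e1.contDiffOn.rpow_const_of_ne fun z hz => ne_of_gt hz.1).smul e2))
  obtain ⟨C, hC⟩ := exists_bound_rescaled (H := EuclideanSpace ℝ (Fin m)) hO hΨO
    (K := Icc (-(1 / 2)) (1 / 2) ×ˢ K ×ˢ Icc (-1) 1)
    (isCompact_Icc.prod (hKc.prod isCompact_Icc))
    (fun z hz => ⟨by linarith [hz.1.1], hK hz.2.1⟩) (‖toBase m d‖ + 1) k
  refine ⟨C, fun c w hw hb u hu j hj hjk => ?_⟩
  set t₀ := c (lastIdx m) with ht₀
  have ht1 : 1 < t₀ := by linarith [hb.one_lt]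
  have ht0 : 0 < t₀ := by linarith
  set ρ := t₀ ^ (-α) with hρ
  obtain ⟨hρ0, hρ1, hρt⟩ : 0 < ρ ∧ ρ ≤ 1 ∧ t₀⁻¹ ≤ ρ := rpow_neg_bounds ht1.le h0 h1
  have hρinv : ρ⁻¹ = t₀ ^ α := by rw [hρ, Real.rpow_neg ht0.le, inv_inv]
  set ℓ : EuclideanSpace ℝ (Fin m) →L[ℝ] ℝ := EuclideanSpace.proj (lastIdx m) with hℓ
  have hℓu (u : EuclideanSpace ℝ (Fin m)) : ℓ u = u (lastIdx m) := rfl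
  set L : EuclideanSpace ℝ (Fin m) →L[ℝ] ℝ × EuclideanSpace ℝ (Fin d) × ℝ :=
    ((ε / t₀) • ℓ).prod (((ε * ρ) • toBase m d).prod ((ε * ρ) • ℓ)) with hL
  have hLu (u : EuclideanSpace ℝ (Fin m)) : L u = ((ε / t₀) * u (lastIdx m),
    (ε * ρ) • toBase m d u, (ε * ρ) * u (lastIdx m)) := rfl
  have hεt : ε / t₀ ≤ ε * ρ := by rw [div_eq_mul_inv]; gcongr
  have hερ : ε * ρ ≤ 1 / 2 := by nlinarith
  have hLn : ‖L‖ ≤ (‖toBase m d‖ + 1) * ρ := by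
    refine ContinuousLinearMap.opNorm_le_bound _ (by positivity) fun u => ?_
    have hu1 : |u (lastIdx m)| ≤ ‖u‖ := abs_apply_le_norm u _
    have hN : 0 ≤ ‖toBase m d‖ := norm_nonneg _
    have hb1 : ε * ρ * ‖u‖ ≤ (‖toBase m d‖ + 1) * ρ * ‖u‖ := by
      gcongr; linarith
    rw [hLu, Prod.norm_def, Prod.norm_def]
    refine max_le ?_ (max_le ?_ ?_)
    · rw [norm_mul, Real.norm_of_nonneg (by positivity), Real.norm_eq_abs]
      refine le_trans ?_ hb1
      gcongr
    · rw [norm_smul, Real.norm_of_nonneg (by positivity)]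
      calc ε * ρ * ‖toBase m d u‖ ≤ 1 * ρ * (‖toBase m d‖ * ‖u‖) := by
            gcongr
            · linarith
            · exact (toBase m d).le_opNorm u
        _ ≤ (‖toBase m d‖ + 1) * ρ * ‖u‖ := by
            have : 0 ≤ ρ * ‖u‖ := by positivity
            nlinarith
    · rw [norm_mul, Real.norm_of_nonneg (by positivity), Real.norm_eq_abs]
      refine le_trans ?_ hb1
      gcongr
  set a : ℝ × EuclideanSpace ℝ (Fin d) × ℝ := (0, toBase m d c, 0) with ha
  have haL (u : EuclideanSpace ℝ (Fin m)) : a + L u = ((ε / t₀) * u (lastIdx m),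
      toBase m d (boxMap c w hw u), (ε * ρ) * u (lastIdx m)) := by
    rw [hLu, ha, hb.toBase_boxMap hw u]
    simp only [Prod.mk_add_mk, zero_add]
    rfl
  have hmem : a + L u ∈ Icc (-(1 / 2)) (1 / 2) ×ˢ K ×ˢ Icc (-1 : ℝ) 1 := by
    rw [haL]
    have hul := abs_le.1 (hu (lastIdx m))
    have hp : 0 < ε / t₀ := by positivity
    have hp' : 0 < ε * ρ := by positivity
    refine ⟨⟨?_, ?_⟩, hb.mem _ (abs_boxMap_sub_le hw hu), ?_, ?_⟩ <;> simp only <;> nlinarith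
  have hcongr : funnelMap α φ ∘ boxMap c w hw =ᶠ[𝓝 u]
      fun u => WithLp.toLp 2 (t₀, 0) + ρ⁻¹ • Ψ (a + L u) := by
    have hOu : ∀ᶠ u' in 𝓝 u, a + L u' ∈ O :=
      ContinuousAt.preimage_mem_nhds (by fun_prop)
        (hO.mem_nhds ⟨by linarith [hmem.1.1], hK hmem.2.1⟩)
    filter_upwards [hOu] with u' hu'
    have hs : 0 < 1 + (ε / t₀) * u' (lastIdx m) := by
      have := hu'.1; rwa [haL] at this
    rw [haL, hΨ, Function.comp_apply, funnelMap, hb.boxMap_lastIdx hw u', hρinv, ← ht₀]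
    have e1 : t₀ + ε * u' (lastIdx m) = t₀ * (1 + ε / t₀ * u' (lastIdx m)) := by
      field_simp
    refine WithLp.ofLp_injective 2 (Prod.ext ?_ ?_)
    · change t₀ + ε * u' (lastIdx m) = t₀ + t₀ ^ α * (ε * ρ * u' (lastIdx m))
      rw [← hρinv]; field_simp
    · change (t₀ + ε * u' (lastIdx m)) ^ α • _ = 0 + t₀ ^ α • _ • _
      rw [e1, Real.mul_rpow ht0.le hs.le, mul_smul, zero_add]
  rw [(hcongr.iteratedFDeriv ℝ j).eq_of_nhds]
  exact hC L ρ a _ hρ0 hρ1 hLn u hmem j hj hjk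

/-- The derivatives of positive order of the rescaled inverse parametrizations of the funnel are
bounded, uniformly over all adapted boxes. -/
theorem exists_bound_boxMap_symm_funnelInv (hmd : m - 1 ≤ d) (hφ : ContDiffOn ℝ ∞ φ φ.source)
    (hKc : IsCompact K) (hK : K ⊆ φ.target) (h0 : 0 ≤ α) (h1 : α ≤ 1) (hε : 0 < ε)
    (hε' : ε ≤ 1 / 2) (k : ℕ) :
    ∃ C : ℝ, ∀ (c w : EuclideanSpace ℝ (Fin m)) (hw : ∀ i, 0 < w i), IsFunnelBox α ε K c w →
      ∀ x : EuclideanSpace ℝ (Fin m), (∀ i, |x i - c i| ≤ w i) → ∀ j, 1 ≤ j → j ≤ k →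
        ‖iteratedFDeriv ℝ j ((boxMap c w hw).symm ∘ funnelInv hmd α φ) (funnelMap α φ x)‖ ≤ C := by
  -- in the variables `s = (t - t₀) / t₀`, `v = t₀ ^ (-α) • z`, `r = t₀ ^ (-α) * (t - t₀)` the
  -- inverse is `t₀ ^ α • Ω`, up to a constant
  set Ω : ℝ × EuclideanSpace ℝ (Fin d) × ℝ → EuclideanSpace ℝ (Fin m) :=
    fun z => ε⁻¹ • (fromBase m d hmd (φ ((1 + z.1) ^ (-α) • z.2.1)) + z.2.2 • lastVec m) with hΩ
  set f : ℝ × EuclideanSpace ℝ (Fin d) × ℝ → EuclideanSpace ℝ (Fin d) :=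
    fun z => (1 + z.1) ^ (-α) • z.2.1 with hf
  have hfc : ContDiffOn ℝ ∞ f {z | 0 < 1 + z.1} := by
    have e1 : ContDiff ℝ ∞ (fun z : ℝ × EuclideanSpace ℝ (Fin d) × ℝ => 1 + z.1) := by fun_prop
    have e2 : ContDiff ℝ ∞ (fun z : ℝ × EuclideanSpace ℝ (Fin d) × ℝ => z.2.1) := by fun_prop
    exact (e1.contDiffOn.rpow_const_of_ne fun z hz => ne_of_gt hz).smul e2.contDiffOn
  set O : Set (ℝ × EuclideanSpace ℝ (Fin d) × ℝ) := {z | 0 < 1 + z.1} ∩ f ⁻¹' φ.source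
  have hO : IsOpen O := hfc.continuousOn.isOpen_inter_preimage
    (isOpen_lt (by fun_prop) (by fun_prop)) φ.open_source
  have hΩO : ContDiffOn ℝ ∞ Ω O := by
    have e1 : ContDiffOn ℝ ∞ (fun z => φ (f z)) O :=
      hφ.comp (hfc.mono inter_subset_left) fun z hz => hz.2
    have e2 : ContDiff ℝ ∞ (fun z : ℝ × EuclideanSpace ℝ (Fin d) × ℝ => z.2.2 • lastVec m) := by
      fun_prop
    exact (((fromBase m d hmd).contDiff.comp_contDiffOn e1).add e2.contDiffOn).const_smul ε⁻¹
  set q : ℝ × EuclideanSpace ℝ (Fin d) × ℝ → ℝ × EuclideanSpace ℝ (Fin d) × ℝ :=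
    fun z => (z.1, (1 + z.1) ^ α • φ.symm z.2.1, z.2.2) with hq
  set Q : Set (ℝ × EuclideanSpace ℝ (Fin d) × ℝ) := Icc (-(1 / 2)) (1 / 2) ×ˢ K ×ˢ Icc (-1) 1
  have hQpos : ∀ z ∈ Q, 0 < 1 + z.1 := fun z hz => by linarith [hz.1.1]
  have hqc : ContinuousOn q Q := by
    have e1 : ContinuousOn (fun z : ℝ × EuclideanSpace ℝ (Fin d) × ℝ => (1 + z.1) ^ α) Q :=
      ContinuousOn.rpow_const (by fun_prop) fun z hz => Or.inl (hQpos z hz).ne'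
    have e2 : ContinuousOn (fun z : ℝ × EuclideanSpace ℝ (Fin d) × ℝ => φ.symm z.2.1) Q :=
      φ.continuousOn_symm.comp (by fun_prop) fun z hz => hK hz.2.1
    exact continuousOn_fst.prodMk ((e1.smul e2).prodMk (by fun_prop))
  have hQc : IsCompact (q '' Q) :=
    (isCompact_Icc.prod (hKc.prod isCompact_Icc)).image_of_continuousOn hqc
  have hQO : q '' Q ⊆ O := by
    rintro _ ⟨z, hz, rfl⟩
    refine ⟨hQpos z hz, ?_⟩
    change (1 + z.1) ^ (-α) • (1 + z.1) ^ α • φ.symm z.2.1 ∈ φ.source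
    rw [rpow_neg_smul_rpow_smul (hQpos z hz)]
    exact φ.map_target (hK hz.2.1)
  obtain ⟨C, hC⟩ := exists_bound_rescaled (H := WithLp 2 (ℝ × EuclideanSpace ℝ (Fin d))) hO hΩO
    hQc hQO 1 k
  refine ⟨C, fun c w hw hb x hx j hj hjk => ?_⟩
  set t₀ := c (lastIdx m) with ht₀
  have ht1 : 1 < t₀ := by linarith [hb.one_lt]
  have ht0 : 0 < t₀ := by linarith
  set ρ := t₀ ^ (-α) with hρ
  obtain ⟨hρ0, hρ1, hρt⟩ : 0 < ρ ∧ ρ ≤ 1 ∧ t₀⁻¹ ≤ ρ := rpow_neg_bounds ht1.le h0 h1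
  set L : WithLp 2 (ℝ × EuclideanSpace ℝ (Fin d)) →L[ℝ] ℝ × EuclideanSpace ℝ (Fin d) × ℝ :=
    (t₀⁻¹ • WithLp.fstL 2 ℝ ℝ (EuclideanSpace ℝ (Fin d))).prod
      ((ρ • WithLp.sndL 2 ℝ ℝ (EuclideanSpace ℝ (Fin d))).prod
        (ρ • WithLp.fstL 2 ℝ ℝ (EuclideanSpace ℝ (Fin d)))) with hL
  have hLz (z : WithLp 2 (ℝ × EuclideanSpace ℝ (Fin d))) :
    L z = (t₀⁻¹ * z.fst, ρ • z.snd, ρ * z.fst) := rfl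
  have hLn : ‖L‖ ≤ 1 * ρ := by
    refine ContinuousLinearMap.opNorm_le_bound _ (by positivity) fun z => ?_
    have hz1 : ‖z.fst‖ ≤ ‖z‖ := WithLp.norm_fst_le _ z
    have hz2 : ‖z.snd‖ ≤ ‖z‖ := WithLp.norm_snd_le _ z
    rw [hLz, Prod.norm_def, Prod.norm_def, one_mul]
    refine max_le ?_ (max_le ?_ ?_)
    · rw [norm_mul, Real.norm_of_nonneg (by positivity)]; gcongr
    · rw [norm_smul, Real.norm_of_nonneg hρ0.le]; gcongr
    · rw [norm_mul, Real.norm_of_nonneg hρ0.le]; gcongr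
  set a : ℝ × EuclideanSpace ℝ (Fin d) × ℝ := (-1, 0, -(ρ * t₀)) with ha
  have haL (z : WithLp 2 (ℝ × EuclideanSpace ℝ (Fin d))) :
      a + L z = (-1 + t₀⁻¹ * z.fst, ρ • z.snd, -(ρ * t₀) + ρ * z.fst) := by
    rw [hLz, ha]
    simp only [Prod.mk_add_mk, zero_add]
  set t := x (lastIdx m) with htx
  have ht : 1 < t := hb.one_lt_of_mem hx
  have htt := abs_le.1 (hx (lastIdx m))
  rw [hb.w_last, ← ht₀, ← htx] at htt
  have hinv1 : t₀⁻¹ ≤ 1 := inv_le_one_of_one_le₀ ht1.le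
  have hinv0 : 0 < t₀⁻¹ := by positivity
  have hmem : a + L (funnelMap α φ x) ∈ q '' Q := by
    refine ⟨(-1 + t₀⁻¹ * t, toBase m d x, -(ρ * t₀) + ρ * t), ⟨?_, hb.mem x hx, ?_⟩, ?_⟩
    · have e : -1 + t₀⁻¹ * t = t₀⁻¹ * (t - t₀) := by field_simp; ring
      simp only [e]
      constructor <;> nlinarith
    · have e : -(ρ * t₀) + ρ * t = ρ * (t - t₀) := by ring
      simp only [e]
      constructor <;> nlinarith
    · rw [haL, hq]
      refine Prod.ext rfl (Prod.ext ?_ rfl)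
      change (1 + (-1 + t₀⁻¹ * t)) ^ α • φ.symm (toBase m d x) =
        ρ • t ^ α • φ.symm (toBase m d x)
      rw [add_neg_cancel_left, smul_smul, Real.mul_rpow hinv0.le (by linarith), hρ,
        Real.rpow_neg ht0.le, Real.inv_rpow ht0.le]
  have hcongr : (boxMap c w hw).symm ∘ funnelInv hmd α φ =ᶠ[𝓝 (funnelMap α φ x)]
      fun z => -((ε * ρ)⁻¹ • fromBase m d hmd (toBase m d c)) + ρ⁻¹ • Ω (a + L z) := by
    have hOz : ∀ᶠ z in 𝓝 (funnelMap α φ x), a + L z ∈ O :=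
      ContinuousAt.preimage_mem_nhds (by fun_prop) (hO.mem_nhds (hQO hmem))
    filter_upwards [hOz] with z hz
    have hs : 0 < 1 + (-1 + t₀⁻¹ * z.fst) := by
      have := hz.1; rwa [haL] at this
    rw [add_neg_cancel_left] at hs
    have hz0 : 0 < z.fst := by
      by_contra hneg
      nlinarith
    have e1 : (1 + (-1 + t₀⁻¹ * z.fst)) ^ (-α) • ρ • z.snd = z.fst ^ (-α) • z.snd := by
      rw [add_neg_cancel_left, smul_smul, Real.mul_rpow hinv0.le hz0.le, hρ, mul_right_comm,
        ← Real.mul_rpow hinv0.le ht0.le, inv_mul_cancel₀ ht0.ne', Real.one_rpow, one_mul]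
    rw [haL, hΩ, Function.comp_apply]
    simp only [e1]
    ext i
    change (funnelInv hmd α φ z i - c i) / w i = _
    simp only [funnelInv, PiLp.add_apply, PiLp.neg_apply, PiLp.smul_apply, smul_eq_mul]
    by_cases h : i.val < m - 1
    · rw [lastVec_of_lt h, hb.w_of_lt i h, ← ht₀, ← hρ, fromBase_apply hmd (toBase m d c),
        dif_pos h, toBase_apply, dif_pos h]
      field_simp
      ring
    · obtain rfl := lastIdx_eq_iff.2 h
      rw [lastVec_lastIdx, fromBase_lastIdx, fromBase_lastIdx, hb.w_last, ← ht₀]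
      field_simp
      ring
  rw [(hcongr.iteratedFDeriv ℝ j).eq_of_nhds]
  exact hC L ρ a _ hρ0 hρ1 hLn _ hmem j hj hjk

end FunnelBox

/-! ### Uniform estimates for the charts of an end -/

section FunnelCharts

variable {m : ℕ} [NeZero m] {M : Type*} [TopologicalSpace M]
  [ChartedSpace (EuclideanHalfSpace m) M]

theorem IsRegularChart.uniqueDiffOn_image_inter {ψ : PartialEquiv M (EuclideanSpace ℝ (Fin m))}
    (h : IsRegularChart ψ) {U : Set M} (hU : IsOpen U) :
    UniqueDiffOn ℝ (ψ '' (ψ.source ∩ U)) := by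
  obtain ⟨O, hO, hO'⟩ := continuousOn_iff'.1 h.contMDiffOn_symm.continuousOn _ hU
  have : ψ '' (ψ.source ∩ U) = ψ.target ∩ O := by
    rw [ψ.image_source_inter_eq' U, inter_comm, hO', inter_comm]
  rw [this]
  exact h.uniqueDiffOn_target.inter hO

variable [IsManifold (𝓡∂ m) ∞ M] {g : Metric m M} {V : Set M} {d : ℕ} {α : ℝ}
  {B : Set (EuclideanSpace ℝ (Fin d))}
  {Φ : PartialEquiv M (WithLp 2 (ℝ × EuclideanSpace ℝ (Fin d)))}
  {φ φ' : OpenPartialHomeomorph (EuclideanSpace ℝ (Fin d)) (EuclideanSpace ℝ (Fin d))}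

/-- The normalized charts of an end obtained from boxes adapted to the funnel. -/
def funnelCharts (h : IsTameEnd g V α B Φ) (hφ : IsBaseChart m B φ) (ε : ℝ)
    (K : Set (EuclideanSpace ℝ (Fin d))) : Set (PartialEquiv M (EuclideanSpace ℝ (Fin m))) :=
  {κ | ∃ (c w : EuclideanSpace ℝ (Fin m)) (hw : ∀ i, 0 < w i), IsFunnelBox α ε K c w ∧
    (c 0 = 0 ∨ w 0 ≤ c 0) ∧ κ = boxChart (endChart h hφ) c w hw}

variable (h : IsTameEnd g V α B Φ) (hφ : IsBaseChart m B φ) (hφ' : IsBaseChart m B φ')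
  {ε ε' : ℝ} {K K' : Set (EuclideanSpace ℝ (Fin d))}
  {κ : PartialEquiv M (EuclideanSpace ℝ (Fin m))}

theorem isTight_of_mem_funnelCharts (hK : K ⊆ φ.target) (hκ : κ ∈ funnelCharts h hφ ε K) :
    IsTight κ ∧ IsNormalizedChart κ ∧ κ.source ⊆ V := by
  obtain ⟨c, w, hw, hb, h0, rfl⟩ := hκ
  obtain ⟨h1, h2⟩ := (isHalfChart_endChart h hφ).boxChart (c := c) (hw := hw) h0
    fun x hx hxb => ⟨⟨hb.one_lt_of_mem hxb, hK (hb.mem x hxb)⟩, hx⟩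
  exact ⟨h1, h2, fun p hp => hp.1.1⟩

/-- In a chart of an end, the isometry onto the funnel is the rescaled parametrization. -/
theorem apply_boxChart_symm {c w : EuclideanSpace ℝ (Fin m)} {hw : ∀ i, 0 < w i} :
    EqOn (Φ ∘ (boxChart (endChart h hφ) c w hw).symm) (funnelMap α φ ∘ boxMap c w hw)
      (boxChart (endChart h hφ) c w hw).target := by
  rintro u hu
  obtain ⟨⟨h1, h2⟩, h3⟩ := (mem_boxChart_target.1 hu).1
  exact h.apply_symm_funnelMap hφ h3 h1 h2

theorem apply_eq_funnelMap {p : M} (hp : p ∈ (endChart h hφ).source) :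
    Φ p = funnelMap α φ (endChart h hφ p) := by
  obtain ⟨⟨h1, h2⟩, h3⟩ := (endChart h hφ).map_source hp
  have e := (endChart h hφ).left_inv hp
  rw [← h.apply_symm_funnelMap hφ h3 h1 h2]
  exact congrArg Φ e.symm

theorem contDiffAt_funnelMap_boxMap {c w : EuclideanSpace ℝ (Fin m)} (hw : ∀ i, 0 < w i)
    (hφ : ContDiffOn ℝ ∞ φ.symm φ.target) (hK : K ⊆ φ.target) (hb : IsFunnelBox α ε K c w)
    {u : EuclideanSpace ℝ (Fin m)} (hu : ∀ i, |u i| ≤ 1) :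
    ContDiffAt ℝ ∞ (funnelMap α φ ∘ boxMap c w hw) u :=
  ((contDiffOn_funnelMap hφ).contDiffAt (isOpen_funnelMapDomain.mem_nhds
    (hb.mem_funnelMapDomain hK (abs_boxMap_sub_le hw hu)))).comp u
      (contDiff_boxMap c w hw).contDiffAt

theorem contDiffAt_boxMap_symm_funnelInv {c w : EuclideanSpace ℝ (Fin m)} (hw : ∀ i, 0 < w i)
    (hmd : m - 1 ≤ d) (hφ : ContDiffOn ℝ ∞ φ φ.source)
    {z : WithLp 2 (ℝ × EuclideanSpace ℝ (Fin d))} (hz : z ∈ funnelInvDomain α φ) :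
    ContDiffAt ℝ ∞ ((boxMap c w hw).symm ∘ funnelInv hmd α φ) z :=
  (contDiff_boxMap_symm c w hw).contDiffAt.comp z
    ((contDiffOn_funnelInv hmd hφ).contDiffAt (isOpen_funnelInvDomain.mem_nhds hz))

/-- The coordinate changes between charts of an end have uniformly bounded derivatives: they factor
through the ambient space of the funnel, as a rescaled inverse parametrization after a rescaled
parametrization. -/
theorem exists_bcNormLE_transition_funnelCharts (hKc : IsCompact K) (hK : K ⊆ φ.target)
    (hε : 0 < ε) (hε2 : ε ≤ 1 / 2) (hKc' : IsCompact K') (hK' : K' ⊆ φ'.target) (hε' : 0 < ε')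
    (hε2' : ε' ≤ 1 / 2) (k : ℕ) :
    ∃ C : ℝ, ∀ κ ∈ funnelCharts h hφ ε K, ∀ κ' ∈ funnelCharts h hφ' ε' K',
      BCNormLE k (κ' ∘ κ.symm) (κ '' (κ.source ∩ κ'.source)) C := by
  obtain ⟨D, hD⟩ := exists_bound_funnelMap_boxMap (m := m) hφ.contDiffOn_symm hKc hK h.nonneg
    h.le_one hε hε2 k
  obtain ⟨C, hC⟩ := exists_bound_boxMap_symm_funnelInv (m := m) h.base_le hφ'.contDiffOn hKc' hK'
    h.nonneg h.le_one hε' hε2' k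
  refine ⟨k.factorial * max C √m * (max 1 D) ^ k, fun κ hκ κ' hκ' => ?_⟩
  have hreg := (isTight_of_mem_funnelCharts h hφ hK hκ).1.isRegularChart
  have hreg' := (isTight_of_mem_funnelCharts h hφ' hK' hκ').1.isRegularChart
  obtain ⟨c, w, hw, hb, -, rfl⟩ := hκ
  obtain ⟨c', w', hw', hb', -, rfl⟩ := hκ'
  set κ := boxChart (endChart h hφ) c w hw
  set κ' := boxChart (endChart h hφ') c' w' hw'
  set G := funnelMap α φ ∘ boxMap c w hw with hG
  set H := (boxMap c' w' hw').symm ∘ funnelInv h.base_le α φ' with hH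
  have hst : κ '' (κ.source ∩ κ'.source) ⊆ κ.target := by
    rintro _ ⟨p, hp, rfl⟩; exact κ.map_source hp.1
  have hEq : EqOn (H ∘ G) (κ' ∘ κ.symm) (κ '' (κ.source ∩ κ'.source)) := fun u hu => by
    change (boxMap c' w' hw').symm (funnelInv h.base_le α φ' (G u)) =
      (boxMap c' w' hw').symm (funnelInv h.base_le α φ' (Φ (κ.symm u)))
    have e : Φ (κ.symm u) = G u := apply_boxChart_symm h hφ (hst hu)
    rw [e]
  have hcube : ∀ u ∈ κ '' (κ.source ∩ κ'.source), ∀ i, |u i| ≤ 1 := fun u hu i =>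
    ((mem_boxChart_target.1 (hst hu)).2 i).le
  have hGd : ∀ u ∈ κ '' (κ.source ∩ κ'.source), ContDiffAt ℝ ∞ G u := fun u hu =>
    contDiffAt_funnelMap_boxMap hw hφ.contDiffOn_symm hK hb (hcube u hu)
  -- a point `G u` is the image under `Φ` of a point in the domain of `κ'`
  have hGu : ∀ u ∈ κ '' (κ.source ∩ κ'.source), ∃ p ∈ κ'.source, G u = Φ p ∧ H (G u) = κ' p := by
    rintro _ ⟨p, ⟨hp, hp'⟩, rfl⟩
    have e : G (κ p) = Φ p := by
      rw [hG, ← apply_boxChart_symm h hφ (κ.map_source hp), Function.comp_apply, κ.left_inv hp]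
    refine ⟨p, hp', e, ?_⟩
    rw [e]; rfl
  have hHd : ∀ u ∈ κ '' (κ.source ∩ κ'.source), ContDiffAt ℝ ∞ H (G u) := fun u hu => by
    obtain ⟨p, hp, e, -⟩ := hGu u hu
    rw [e]
    exact contDiffAt_boxMap_symm_funnelInv hw' h.base_le hφ'.contDiffOn hp.1.2
  refine BCNormLE.congr ?_ hEq.symm
  refine bcNormLE_of_iteratedFDeriv (hreg.uniqueDiffOn_image_inter hreg'.isOpen_source)
    (fun u hu => (hHd u hu).comp u (hGd u hu)) fun j hj u hu => ?_
  have h1 := norm_iteratedFDeriv_comp_le_of_contDiffAt (n := j) (hHd u hu) (hGd u hu)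
    (le_max_left 1 D) (C := max C √m) ?_ ?_
  · refine h1.trans ?_
    have : 0 ≤ max C √m := le_max_of_le_right (Real.sqrt_nonneg _)
    gcongr
    exact le_max_left _ _
  · intro i hi
    obtain ⟨p, hp, e, e'⟩ := hGu u hu
    rcases Nat.eq_zero_or_pos i with rfl | hi0
    · rw [norm_iteratedFDeriv_zero, e']
      exact (norm_le_of_mem_cube (κ'.map_source hp).2).trans (le_max_right _ _)
    · rw [e, apply_eq_funnelMap h hφ' hp.1]
      exact (hC c' w' hw' hb' _ (fun i => ((mem_boxChart_source.1 hp).2 i).le) i hi0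
        (hi.trans hj)).trans (le_max_left _ _)
  · intro i hi0 hi
    exact (hD c w hw hb u (hcube u hu) i hi0 (hi.trans hj)).trans (le_max_right _ _)

/-- The pullback of the Euclidean inner product by a linear map. -/
def innerPullback {E W : Type*} [NormedAddCommGroup E] [NormedSpace ℝ E] [NormedAddCommGroup W]
    [InnerProductSpace ℝ W] (D : E →L[ℝ] W) : E →L[ℝ] E →L[ℝ] ℝ :=
  (innerSL ℝ : W →L[ℝ] W →L[ℝ] ℝ).bilinearComp D D

theorem contDiff_innerPullback {E W : Type*} [NormedAddCommGroup E] [NormedSpace ℝ E]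
    [FiniteDimensional ℝ E] [NormedAddCommGroup W] [InnerProductSpace ℝ W] :
    ContDiff ℝ ∞ (innerPullback : (E →L[ℝ] W) → E →L[ℝ] E →L[ℝ] ℝ) := by
  refine contDiff_clm_apply_iff.2 fun ξ => contDiff_clm_apply_iff.2 fun η => ?_
  change ContDiff ℝ ∞ fun D : E →L[ℝ] W => inner ℝ (D ξ) (D η)
  exact (contDiff_id.clm_apply contDiff_const).inner ℝ (contDiff_id.clm_apply contDiff_const)

/-- In a chart of an end, the metric is the pullback of the Euclidean inner product by the
derivative of the rescaled parametrization. -/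
theorem pushforwardMetric_eqOn_funnelCharts (hK : K ⊆ φ.target) {c w : EuclideanSpace ℝ (Fin m)}
    {hw : ∀ i, 0 < w i} (hb : IsFunnelBox α ε K c w)
    (hreg : IsRegularChart (boxChart (endChart h hφ) c w hw)) :
    EqOn (innerPullback ∘ fderiv ℝ (funnelMap α φ ∘ boxMap c w hw))
      (pushforwardMetric g (boxChart (endChart h hφ) c w hw))
      (boxChart (endChart h hφ) c w hw).target := by
  intro u hu
  have hd : DifferentiableAt ℝ (funnelMap α φ ∘ boxMap c w hw) u :=
    (contDiffAt_funnelMap_boxMap hw hφ.contDiffOn_symm hK hb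
      fun i => ((mem_boxChart_target.1 hu).2 i).le).differentiableAt (by simp)
  have hV : (boxChart (endChart h hφ) c w hw).symm u ∈ V :=
    ((boxChart (endChart h hφ) c w hw).map_target hu).1.1
  ext ξ η
  rw [h.isometry.pushforwardMetric_apply h.isOpen hreg hu hV,
    fderivWithin_congr (apply_boxChart_symm h hφ) (apply_boxChart_symm h hφ hu),
    hd.fderivWithin (hreg.uniqueDiffOn_target u hu)]
  rfl

theorem exists_bcNormLE_pushforwardMetric_funnelCharts (hKc : IsCompact K) (hK : K ⊆ φ.target)
    (hε : 0 < ε) (hε2 : ε ≤ 1 / 2) (k : ℕ) :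
    ∃ C : ℝ, ∀ κ ∈ funnelCharts h hφ ε K, BCNormLE k (pushforwardMetric g κ) κ.target C := by
  obtain ⟨D, hD⟩ := exists_bound_funnelMap_boxMap (m := m) hφ.contDiffOn_symm hKc hK h.nonneg
    h.le_one hε hε2 (k + 1)
  obtain ⟨C, hC⟩ := exists_bound_iteratedFDerivWithin uniqueDiffOn_univ
    (contDiff_innerPullback (E := EuclideanSpace ℝ (Fin m))
      (W := WithLp 2 (ℝ × EuclideanSpace ℝ (Fin d)))).contDiffOn
    (isCompact_closedBall (0 : EuclideanSpace ℝ (Fin m) →L[ℝ]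
      WithLp 2 (ℝ × EuclideanSpace ℝ (Fin d))) D) (subset_univ _) k
  refine ⟨k.factorial * max C 0 * (max 1 D) ^ k, fun κ hκ => ?_⟩
  have hreg := (isTight_of_mem_funnelCharts h hφ hK hκ).1.isRegularChart
  obtain ⟨c, w, hw, hb, -, rfl⟩ := hκ
  have hcube : ∀ u ∈ (boxChart (endChart h hφ) c w hw).target, ∀ i, |u i| ≤ 1 := fun u hu i =>
    ((mem_boxChart_target.1 hu).2 i).le
  have hGd : ∀ u ∈ (boxChart (endChart h hφ) c w hw).target,
      ContDiffAt ℝ ∞ (fderiv ℝ (funnelMap α φ ∘ boxMap c w hw)) u := fun u hu =>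
    (contDiffAt_funnelMap_boxMap hw hφ.contDiffOn_symm hK hb (hcube u hu)).fderiv_right (by simp)
  refine BCNormLE.congr ?_ (pushforwardMetric_eqOn_funnelCharts h hφ hK hb hreg).symm
  refine bcNormLE_of_iteratedFDeriv hreg.uniqueDiffOn_target
    (fun u hu => contDiff_innerPullback.contDiffAt.comp u (hGd u hu)) fun j hj u hu => ?_
  have h1 := norm_iteratedFDeriv_comp_le_of_contDiffAt (n := j)
    contDiff_innerPullback.contDiffAt (hGd u hu) (le_max_left 1 D) (C := max C 0) ?_ ?_
  · refine h1.trans ?_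
    gcongr
    exact le_max_left _ _
  · intro i hi
    have hmem : fderiv ℝ (funnelMap α φ ∘ boxMap c w hw) u ∈ Metric.closedBall 0 D := by
      rw [mem_closedBall_zero_iff, ← norm_iteratedFDeriv_one]
      exact hD c w hw hb u (hcube u hu) 1 le_rfl (by omega)
    have := hC i (hi.trans hj) _ hmem
    rw [iteratedFDerivWithin_univ] at this
    exact this.trans (le_max_left _ _)
  · intro i hi0 hi
    rw [norm_iteratedFDeriv_fderiv]
    exact (hD c w hw hb u (hcube u hu) (i + 1) (by omega) (by omega)).trans (le_max_right _ _)

/-- The metric is uniformly equivalent to the Euclidean one, because the rescaled parametrizations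
and their inverses have uniformly bounded first derivatives. -/
theorem exists_equivalent_pushforwardMetric_funnelCharts (hKc : IsCompact K) (hK : K ⊆ φ.target)
    (hε : 0 < ε) (hε2 : ε ≤ 1 / 2) :
    ∃ c : ℝ, 1 ≤ c ∧ ∀ κ ∈ funnelCharts h hφ ε K, ∀ x ∈ κ.target,
      ∀ ξ : EuclideanSpace ℝ (Fin m), ‖ξ‖ ^ 2 / c ≤ pushforwardMetric g κ x ξ ξ ∧
        pushforwardMetric g κ x ξ ξ ≤ c * ‖ξ‖ ^ 2 := by
  obtain ⟨D, hD⟩ := exists_bound_funnelMap_boxMap (m := m) hφ.contDiffOn_symm hKc hK h.nonneg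
    h.le_one hε hε2 1
  obtain ⟨C, hC⟩ := exists_bound_boxMap_symm_funnelInv (m := m) h.base_le hφ.contDiffOn hKc hK
    h.nonneg h.le_one hε hε2 1
  refine ⟨max 1 (max (D ^ 2) (C ^ 2)), le_max_left _ _, fun κ hκ u hu ξ => ?_⟩
  have hreg := (isTight_of_mem_funnelCharts h hφ hK hκ).1.isRegularChart
  obtain ⟨c, w, hw, hb, -, rfl⟩ := hκ
  have hcube : ∀ i, |u i| ≤ 1 := fun i => ((mem_boxChart_target.1 hu).2 i).le
  rw [← pushforwardMetric_eqOn_funnelCharts h hφ hK hb hreg hu]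
  set G := funnelMap α φ ∘ boxMap c w hw with hG
  set H := (boxMap c w hw).symm ∘ funnelInv h.base_le α φ with hH
  change ‖ξ‖ ^ 2 / _ ≤ inner ℝ (fderiv ℝ G u ξ) (fderiv ℝ G u ξ) ∧
    inner ℝ (fderiv ℝ G u ξ) (fderiv ℝ G u ξ) ≤ _
  rw [real_inner_self_eq_norm_sq]
  have hbox := abs_boxMap_sub_le (c := c) hw hcube
  have hdom := hb.mem_funnelMapDomain hK hbox
  have hGd : DifferentiableAt ℝ G u :=
    (contDiffAt_funnelMap_boxMap hw hφ.contDiffOn_symm hK hb hcube).differentiableAt (by simp)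
  have hHd : DifferentiableAt ℝ H (G u) :=
    (contDiffAt_boxMap_symm_funnelInv hw h.base_le hφ.contDiffOn
      (funnelMap_mem_funnelInvDomain hdom)).differentiableAt (by simp)
  have hDn : ‖fderiv ℝ G u‖ ≤ D := by
    rw [← norm_iteratedFDeriv_one]; exact hD c w hw hb u hcube 1 le_rfl le_rfl
  have hCn : ‖fderiv ℝ H (G u)‖ ≤ C := by
    rw [← norm_iteratedFDeriv_one]; exact hC c w hw hb _ hbox 1 le_rfl le_rfl
  have hid : H ∘ G =ᶠ[𝓝 u] id := by
    have : ∀ᶠ u' in 𝓝 u, boxMap c w hw u' ∈ funnelMapDomain m φ :=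
      (contDiff_boxMap c w hw).continuous.continuousAt.preimage_mem_nhds
        (isOpen_funnelMapDomain.mem_nhds hdom)
    filter_upwards [this] with u' hu'
    simp only [hH, hG, Function.comp_apply, funnelInv_funnelMap h.base_le hu', id,
      Equiv.symm_apply_apply]
  have hξ : fderiv ℝ H (G u) (fderiv ℝ G u ξ) = ξ := by
    have e := hid.fderiv_eq (𝕜 := ℝ)
    rw [fderiv_comp u hHd hGd, fderiv_id] at e
    exact DFunLike.congr_fun e ξ
  have h1 : ‖fderiv ℝ G u ξ‖ ≤ D * ‖ξ‖ := (fderiv ℝ G u).le_of_opNorm_le hDn ξ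
  have h2 : ‖ξ‖ ≤ C * ‖fderiv ℝ G u ξ‖ := by
    conv_lhs => rw [← hξ]
    exact (fderiv ℝ H (G u)).le_of_opNorm_le hCn _
  constructor
  · rw [div_le_iff₀ (by positivity)]
    calc ‖ξ‖ ^ 2 ≤ (C * ‖fderiv ℝ G u ξ‖) ^ 2 := by gcongr
      _ = ‖fderiv ℝ G u ξ‖ ^ 2 * C ^ 2 := by ring
      _ ≤ _ := by
        gcongr
        exact (le_max_right _ _).trans (le_max_right _ _)
  · calc ‖fderiv ℝ G u ξ‖ ^ 2 ≤ (D * ‖ξ‖) ^ 2 := by gcongr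
      _ = D ^ 2 * ‖ξ‖ ^ 2 := by ring
      _ ≤ _ := by
        gcongr
        exact (le_max_left _ _).trans (le_max_right _ _)

end FunnelCharts

/-! ### Uniform families of charts -/

section UniformFamily

theorem bcNormLE_transition_of_disjoint {m : ℕ} {M : Type*}
    {κ κ' : PartialEquiv M (EuclideanSpace ℝ (Fin m))}
    (h : Disjoint κ.source κ'.source) (k : ℕ) (c : ℝ) :
    BCNormLE k (κ' ∘ κ.symm) (κ '' (κ.source ∩ κ'.source)) c := by
  rw [h.inter_eq, image_empty]
  exact fun j _ x hx => hx.elim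

variable {m : ℕ} [NeZero m] {M : Type*} [TopologicalSpace M]
  [ChartedSpace (EuclideanHalfSpace m) M] [IsManifold (𝓡∂ m) ∞ M]

/-- A family of charts that satisfies all the requirements of `IsUniformlyRegular` except that it
need not cover `M`; moreover its charts have relatively compact domains, and only finitely many of
them meet a given compact set. -/
structure IsUniformFamily (g : Metric m M)
    (𝒦 : Set (PartialEquiv M (EuclideanSpace ℝ (Fin m)))) : Prop where
  tight : ∀ κ ∈ 𝒦, IsTight κ
  normalized : ∀ κ ∈ 𝒦, IsNormalizedChart κ
  multiplicity : ∃ N : ℕ, ∀ p : M, {κ ∈ 𝒦 | p ∈ κ.source}.encard ≤ N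
  transition : ∀ k : ℕ, ∃ c : ℝ, ∀ κ ∈ 𝒦, ∀ κ' ∈ 𝒦,
    BCNormLE k (κ' ∘ κ.symm) (κ '' (κ.source ∩ κ'.source)) c
  equivalent : ∃ c : ℝ, 1 ≤ c ∧ ∀ κ ∈ 𝒦, ∀ x ∈ κ.target, ∀ ξ : EuclideanSpace ℝ (Fin m),
    ‖ξ‖ ^ 2 / c ≤ pushforwardMetric g κ x ξ ξ ∧ pushforwardMetric g κ x ξ ξ ≤ c * ‖ξ‖ ^ 2
  bounded : ∀ k : ℕ, ∃ c : ℝ, ∀ κ ∈ 𝒦, BCNormLE k (pushforwardMetric g κ) κ.target c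
  locallyFinite : ∀ L : Set M, IsCompact L → {κ ∈ 𝒦 | (κ.source ∩ L).Nonempty}.Finite

variable {g : Metric m M}

/-- A finite union of uniform families is uniform if the coordinate changes between different
families are. -/
theorem IsUniformFamily.iUnion {ι : Type*} [Finite ι]
    {𝒦 : ι → Set (PartialEquiv M (EuclideanSpace ℝ (Fin m)))}
    (h : ∀ i, IsUniformFamily g (𝒦 i))
    (ht : ∀ i j, i ≠ j → ∀ k : ℕ, ∃ c : ℝ, ∀ κ ∈ 𝒦 i, ∀ κ' ∈ 𝒦 j,
      BCNormLE k (κ' ∘ κ.symm) (κ '' (κ.source ∩ κ'.source)) c) :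
    IsUniformFamily g (⋃ i, 𝒦 i) where
  tight κ hκ := by
    obtain ⟨i, hi⟩ := mem_iUnion.1 hκ
    exact (h i).tight κ hi
  normalized κ hκ := by
    obtain ⟨i, hi⟩ := mem_iUnion.1 hκ
    exact (h i).normalized κ hi
  multiplicity := by
    cases nonempty_fintype ι
    choose N hN using fun i => (h i).multiplicity
    refine ⟨∑ i, N i, fun p => ?_⟩
    have : {κ ∈ ⋃ i, 𝒦 i | p ∈ κ.source} = ⋃ i, {κ ∈ 𝒦 i | p ∈ κ.source} := by
      ext κ; simp
    rw [this, Nat.cast_sum]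
    exact (encard_iUnion_le_of_fintype _).trans (Finset.sum_le_sum fun i _ => hN i p)
  transition k := by
    have : ∀ q : ι × ι, ∃ c : ℝ, ∀ κ ∈ 𝒦 q.1, ∀ κ' ∈ 𝒦 q.2,
        BCNormLE k (κ' ∘ κ.symm) (κ '' (κ.source ∩ κ'.source)) c := fun ⟨i, j⟩ => by
      by_cases hij : i = j
      · subst hij; exact (h i).transition k
      · exact ht i j hij k
    choose c hc using this
    obtain ⟨C, hC⟩ := Finite.exists_le c
    refine ⟨C, fun κ hκ κ' hκ' => ?_⟩
    obtain ⟨i, hi⟩ := mem_iUnion.1 hκ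
    obtain ⟨j, hj⟩ := mem_iUnion.1 hκ'
    exact (hc (i, j) κ hi κ' hj).mono (hC _)
  equivalent := by
    choose c hc1 hc using fun i => (h i).equivalent
    obtain ⟨C, hC⟩ := Finite.exists_le c
    refine ⟨max 1 C, le_max_left _ _, fun κ hκ x hx ξ => ?_⟩
    obtain ⟨i, hi⟩ := mem_iUnion.1 hκ
    obtain ⟨h1, h2⟩ := hc i κ hi x hx ξ
    have hci : 0 < c i := one_pos.trans_le (hc1 i)
    have hcC : c i ≤ max 1 C := (hC i).trans (le_max_right _ _)
    exact ⟨le_trans (by gcongr) h1, h2.trans (by gcongr)⟩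
  bounded k := by
    choose c hc using fun i => (h i).bounded k
    obtain ⟨C, hC⟩ := Finite.exists_le c
    refine ⟨C, fun κ hκ => ?_⟩
    obtain ⟨i, hi⟩ := mem_iUnion.1 hκ
    exact (hc i κ hi).mono (hC i)
  locallyFinite L hL := by
    have : {κ ∈ ⋃ i, 𝒦 i | (κ.source ∩ L).Nonempty} =
        ⋃ i, {κ ∈ 𝒦 i | (κ.source ∩ L).Nonempty} := by
      ext κ; simp
    rw [this]
    exact finite_iUnion fun i => (h i).locallyFinite L hL

variable [T2Space M] {κ : PartialEquiv M (EuclideanSpace ℝ (Fin m))}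

theorem isUniformFamily_singleton (g : Metric m M) (h : IsTight κ) (hn : IsNormalizedChart κ) :
    IsUniformFamily g {κ} where
  tight κ' hκ' := by rwa [mem_singleton_iff.1 hκ']
  normalized κ' hκ' := by rwa [mem_singleton_iff.1 hκ']
  multiplicity := ⟨1, fun p => (encard_le_encard (sep_subset _ _)).trans (by simp)⟩
  transition k := by
    obtain ⟨c, hc⟩ := h.exists_bcNormLE_transition h k
    exact ⟨c, by simpa using hc⟩
  equivalent := by
    obtain ⟨c, hc1, hc⟩ := h.exists_equivalent_pushforwardMetric g
    exact ⟨c, hc1, by simpa using hc⟩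
  bounded k := by
    obtain ⟨c, hc⟩ := h.exists_bcNormLE_pushforwardMetric g k
    exact ⟨c, by simpa using hc⟩
  locallyFinite L _ := (finite_singleton κ).subset (sep_subset _ _)

/-- Adding a chart with relatively compact domain preserves uniformity, because the new chart meets
only finitely many of the old ones. -/
theorem IsUniformFamily.insert {𝒦 : Set (PartialEquiv M (EuclideanSpace ℝ (Fin m)))}
    (h : IsUniformFamily g 𝒦) (hκ : IsTight κ) (hn : IsNormalizedChart κ) :
    IsUniformFamily g (insert κ 𝒦) := by
  obtain ⟨L, hL, hκL⟩ := hκ.exists_isCompact_superset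
  -- only the finitely many charts that meet the compact set `L` matter
  have hfin := (h.locallyFinite L hL).to_subtype
  have hdisj : ∀ κ' ∈ 𝒦, κ' ∉ {κ' ∈ 𝒦 | (κ'.source ∩ L).Nonempty} →
      Disjoint κ.source κ'.source := fun κ' hκ' hn => by
    refine disjoint_left.2 fun p hp hp' => hn ⟨hκ', p, hp', hκL hp⟩
  rw [insert_eq, union_eq_iUnion]
  refine IsUniformFamily.iUnion (Bool.rec h (isUniformFamily_singleton g hκ hn)) ?_
  rintro (_ | _) (_ | _) hij k
  · exact absurd rfl hij
  · choose c hc using fun κ' : {κ' ∈ 𝒦 | (κ'.source ∩ L).Nonempty} =>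
      (h.tight κ' κ'.2.1).exists_bcNormLE_transition hκ k
    obtain ⟨C, hC⟩ := Finite.exists_le c
    refine ⟨C, fun κ' hκ' κ'' hκ'' => ?_⟩
    obtain rfl : κ'' = κ := hκ''
    by_cases hmem : κ' ∈ {κ' ∈ 𝒦 | (κ'.source ∩ L).Nonempty}
    · exact (hc ⟨κ', hmem⟩).mono (hC _)
    · exact bcNormLE_transition_of_disjoint (hdisj κ' hκ' hmem).symm k C
  · choose c hc using fun κ' : {κ' ∈ 𝒦 | (κ'.source ∩ L).Nonempty} =>
      hκ.exists_bcNormLE_transition (h.tight κ' κ'.2.1) k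
    obtain ⟨C, hC⟩ := Finite.exists_le c
    refine ⟨C, fun κ'' hκ'' κ' hκ' => ?_⟩
    obtain rfl : κ'' = κ := hκ''
    by_cases hmem : κ' ∈ {κ' ∈ 𝒦 | (κ'.source ∩ L).Nonempty}
    · exact (hc ⟨κ', hmem⟩).mono (hC _)
    · exact bcNormLE_transition_of_disjoint (hdisj κ' hκ' hmem) k C
  · exact absurd rfl hij

theorem IsUniformFamily.union_of_finite {𝒦 𝒦₀ : Set (PartialEquiv M (EuclideanSpace ℝ (Fin m)))}
    (h : IsUniformFamily g 𝒦) (hfin : 𝒦₀.Finite) (hκ : ∀ κ ∈ 𝒦₀, IsTight κ ∧ IsNormalizedChart κ) :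
    IsUniformFamily g (𝒦₀ ∪ 𝒦) := by
  induction 𝒦₀, hfin using Set.Finite.induction_on with
  | empty => simpa using h
  | insert _ _ ih =>
    rw [insert_union]
    exact (ih fun κ hκ' => hκ κ (mem_insert_of_mem _ hκ')).insert (hκ _ (mem_insert _ _)).1
      (hκ _ (mem_insert _ _)).2

end UniformFamily

/-! ### Grids of boxes in an end -/

section Grid

/-- Every real number is within `3 w / 4` of a multiple `k w / 2`. For nonnegative numbers `k = 1`
is not needed: the interval of radius `w` about `w / 2` would cross `0` without being centered
there. -/
theorem exists_int_abs_sub_lt {w : ℝ} (hw : 0 < w) (x : ℝ) :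
    ∃ k : ℤ, |x - k * w / 2| < 3 / 4 * w ∧ (0 ≤ x → k = 0 ∨ 2 ≤ k) := by
  by_cases hx : 0 ≤ x ∧ x < 3 / 4 * w
  · refine ⟨0, ?_, fun _ => Or.inl rfl⟩
    rw [Int.cast_zero, zero_mul, zero_div, sub_zero, abs_of_nonneg hx.1]
    exact hx.2
  · have h1 := abs_le.1 (abs_sub_round (2 * x / w))
    set k := round (2 * x / w)
    have e : 2 * x / w * w = 2 * x := div_mul_cancel₀ _ hw.ne'
    refine ⟨k, ?_, fun h0 => Or.inr ?_⟩
    · rw [abs_lt]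
      constructor <;> nlinarith [mul_le_mul_of_nonneg_right h1.1 hw.le,
        mul_le_mul_of_nonneg_right h1.2 hw.le]
    · have h2 : 3 / 4 * w ≤ x := not_lt.1 fun h => hx ⟨h0, h⟩
      have h3 : (3 / 2 : ℝ) ≤ 2 * x / w := by
        rw [le_div_iff₀ hw]; linarith
      have h4 : (1 : ℝ) ≤ k := by linarith [h1.2]
      rcases (show (1 : ℤ) ≤ k by exact_mod_cast h4).eq_or_lt with h5 | h5
      · exfalso
        -- rounding half up takes `3 / 2` to `2`
        have h6 : ⌊2 * x / w + 1 / 2⌋ = k := (round_eq _).symm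
        have h7 : (2 : ℤ) ≤ ⌊2 * x / w + 1 / 2⌋ := Int.le_floor.2 (by push_cast; linarith)
        omega
      · exact h5

/-- The multiples `k w / 2` at distance less than `w` from `x` have different `k` modulo `4`. -/
theorem int_eq_of_abs_sub_lt {w x : ℝ} (hw : 0 < w) {k k' : ℤ} (h : |x - k * w / 2| < w)
    (h' : |x - k' * w / 2| < w) (hmod : (k : ZMod 4) = k') : k = k' := by
  have h1 : |((k - k' : ℤ) : ℝ)| < 4 := by
    rw [abs_lt] at *
    push_cast
    constructor <;> nlinarith
  have h2 : |k - k'| < 4 := by exact_mod_cast h1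
  have h3 : (4 : ℤ) ∣ k' - k := (ZMod.intCast_eq_intCast_iff_dvd_sub k k' 4).1 hmod
  rw [abs_lt] at h2
  omega

variable {m : ℕ} [NeZero m]

/-- The half side lengths of the box with index `k` in the grid of mesh size `ε` for the
`α`-funnel. -/
def gridWidth (α ε : ℝ) (k : Fin m → ℤ) : EuclideanSpace ℝ (Fin m) :=
  WithLp.toLp 2 fun j => if j = lastIdx m then ε else ε * (k (lastIdx m) * ε / 2) ^ (-α)

/-- The center of the box with index `k`; neighboring boxes of the same height overlap, as their
centers are half a width apart. -/
def gridCenter (α ε : ℝ) (k : Fin m → ℤ) : EuclideanSpace ℝ (Fin m) :=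
  WithLp.toLp 2 fun j => k j * gridWidth α ε k j / 2

variable {α ε : ℝ} {k k' : Fin m → ℤ}

theorem gridWidth_lastIdx : gridWidth α ε k (lastIdx m) = ε := if_pos rfl

theorem gridCenter_apply (j : Fin m) : gridCenter α ε k j = k j * gridWidth α ε k j / 2 := rfl

theorem gridCenter_lastIdx : gridCenter α ε k (lastIdx m) = k (lastIdx m) * ε / 2 := by
  rw [gridCenter_apply, gridWidth_lastIdx]

theorem gridWidth_of_lt {j : Fin m} (hj : j.val < m - 1) :
    gridWidth α ε k j = ε * gridCenter α ε k (lastIdx m) ^ (-α) := by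
  rw [gridCenter_lastIdx]
  exact if_neg fun h => lastIdx_eq_iff.1 h hj

theorem gridWidth_congr (h : k (lastIdx m) = k' (lastIdx m)) :
    gridWidth α ε k = gridWidth α ε k' := by
  rw [gridWidth, gridWidth, h]

theorem gridWidth_pos (hε : 0 < ε) (h : 0 < gridCenter α ε k (lastIdx m)) (j : Fin m) :
    0 < gridWidth α ε k j := by
  by_cases hj : j.val < m - 1
  · rw [gridWidth_of_lt hj]
    exact mul_pos hε (Real.rpow_pos_of_pos h _)
  · rw [lastIdx_eq_iff.2 hj, gridWidth_lastIdx]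
    exact hε

variable {M : Type*} [TopologicalSpace M] [ChartedSpace (EuclideanHalfSpace m) M]
  [IsManifold (𝓡∂ m) ∞ M] {g : Metric m M} {V : Set M} {d : ℕ} {B : Set (EuclideanSpace ℝ (Fin d))}
  {Φ : PartialEquiv M (WithLp 2 (ℝ × EuclideanSpace ℝ (Fin d)))}
  {φ : OpenPartialHomeomorph (EuclideanSpace ℝ (Fin d)) (EuclideanSpace ℝ (Fin d))}

/-- The charts of an end that correspond to the boxes of the grid lying above `K`. Boxes that cross
the boundary of the half-space without being centered on it are left out. -/
def gridCharts (h : IsTameEnd g V α B Φ) (hφ : IsBaseChart m B φ) (ε : ℝ)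
    (K : Set (EuclideanSpace ℝ (Fin d))) : Set (PartialEquiv M (EuclideanSpace ℝ (Fin m))) :=
  {κ | ∃ (k : Fin m → ℤ) (hw : ∀ i, 0 < gridWidth α ε k i),
    IsFunnelBox α ε K (gridCenter α ε k) (gridWidth α ε k) ∧ (k 0 = 0 ∨ 2 ≤ k 0) ∧
    κ = boxChart (endChart h hφ) (gridCenter α ε k) (gridWidth α ε k) hw}

variable (h : IsTameEnd g V α B Φ) (hφ : IsBaseChart m B φ) {K : Set (EuclideanSpace ℝ (Fin d))}

theorem gridCharts_subset : gridCharts h hφ ε K ⊆ funnelCharts h hφ ε K := by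
  rintro κ ⟨k, hw, hb, h0, rfl⟩
  refine ⟨_, _, hw, hb, ?_, rfl⟩
  rw [gridCenter_apply]
  rcases h0 with h0 | h0
  · left; rw [h0]; simp
  · right
    have : (2 : ℝ) ≤ k 0 := by exact_mod_cast h0
    nlinarith [hw 0]

/-- A point lies in at most `4 ^ m` boxes of a grid: among the indices of the boxes that contain it,
the last one takes at most four consecutive values, and for a fixed last index the widths are
fixed, so that the same holds for the others. -/
theorem encard_gridCharts_le (hε : 0 < ε) (p : M) :
    {κ ∈ gridCharts h hφ ε K | p ∈ κ.source}.encard ≤ ((4 ^ m : ℕ) : ℕ∞) := by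
  have : ∀ κ ∈ {κ ∈ gridCharts h hφ ε K | p ∈ κ.source}, ∃ k : Fin m → ℤ,
      ∃ hw : ∀ i, 0 < gridWidth α ε k i,
        κ = boxChart (endChart h hφ) (gridCenter α ε k) (gridWidth α ε k) hw := by
    rintro κ ⟨⟨k, hw, -, -, e⟩, -⟩
    exact ⟨k, hw, e⟩
  choose! k hw hk using this
  -- a chart containing `p` is determined by its index modulo 4
  refine (encard_le_encard_of_injOn (f := fun κ j => (k κ j : ZMod 4))
    (t := (univ : Set (Fin m → ZMod 4))) (mapsTo_univ _ _) ?_).trans (le_of_eq ?_)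
  · intro κ hκ κ' hκ' hmod
    have hp := (mem_boxChart_source.1 (hk κ hκ ▸ hκ.2)).2
    have hp' := (mem_boxChart_source.1 (hk κ' hκ' ▸ hκ'.2)).2
    have hlast : k κ (lastIdx m) = k κ' (lastIdx m) := by
      have h1 := hp (lastIdx m)
      have h2 := hp' (lastIdx m)
      rw [gridCenter_lastIdx, gridWidth_lastIdx] at h1 h2
      exact int_eq_of_abs_sub_lt hε h1 h2 (congrFun hmod _)
    have hw' := gridWidth_congr (α := α) (ε := ε) hlast
    have hkk : k κ = k κ' := funext fun j => by
      have h1 := hp j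
      have h2 := hp' j
      rw [gridCenter_apply] at h1 h2
      rw [← hw'] at h2
      exact int_eq_of_abs_sub_lt (hw κ hκ j) h1 h2 (congrFun hmod j)
    rw [hk κ hκ, hk κ' hκ']
    congr 1
    all_goals rw [hkk]
  · rw [encard_univ, ENat.card_eq_coe_fintype_card]
    simp

/-- A grid is locally finite in `M`, because the height is bounded on compact subsets of `M`. -/
theorem finite_gridCharts_inter [T2Space M] (hε : 0 < ε) (hK : IsCompact K) {L : Set M}
    (hL : IsCompact L) : {κ ∈ gridCharts h hφ ε K | (κ.source ∩ L).Nonempty}.Finite := by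
  obtain ⟨R, hR⟩ := h.exists_fst_le_of_isCompact hL
  obtain ⟨A, hA⟩ := hK.isBounded.exists_norm_le
  set R' := max R 0 + ε with hR'
  have hR'0 : 0 < R' := by positivity
  set N : ℤ := ⌈max (2 * R' / ε) (2 * max A 0 * R' / ε)⌉
  have : ∀ κ ∈ {κ ∈ gridCharts h hφ ε K | (κ.source ∩ L).Nonempty}, ∃ k : Fin m → ℤ,
      (∃ hw : ∀ i, 0 < gridWidth α ε k i,
        κ = boxChart (endChart h hφ) (gridCenter α ε k) (gridWidth α ε k) hw) ∧
      k ∈ Icc (fun _ => -N) (fun _ => N) := by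
    rintro κ ⟨⟨k, hw, hb, -, e⟩, p, hp, hpL⟩
    refine ⟨k, ⟨hw, e⟩, ?_⟩
    rw [e] at hp
    obtain ⟨hps, hpc⟩ := mem_boxChart_source.1 hp
    have hpt : endChart h hφ p (lastIdx m) = (Φ p).fst := by
      obtain ⟨t, ht, y, hy, e⟩ := h.exists_apply_eq hps.1
      change funnelInv h.base_le α φ (Φ p) (lastIdx m) = _
      rw [e, funnelInv_toLp _ (one_pos.trans ht), fromBase_add_lastIdx]
      rfl
    have h1 := hb.one_lt
    have hcR : gridCenter α ε k (lastIdx m) ≤ R' := by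
      have h2 := (abs_lt.1 (hpc (lastIdx m))).1
      rw [hpt, gridWidth_lastIdx] at h2
      linarith [hR p ⟨hpL, hps.1⟩, le_max_left R 0]
    have hkN : ∀ j, |(k j : ℝ)| ≤ N := by
      intro j
      refine le_trans ?_ (Int.le_ceil _)
      by_cases hj : j.val < m - 1
      · refine le_trans ?_ (le_max_right _ _)
        have hcA : |gridCenter α ε k j| ≤ max A 0 := by
          have h2 := hA _ (hb.mem (gridCenter α ε k) fun i => by simpa using (hw i).le)
          have h3 := PiLp.norm_apply_le (toBase m d (gridCenter α ε k))
            (⟨j.val, by have := h.base_le; omega⟩ : Fin d)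
          rw [toBase_apply, dif_pos hj] at h3
          exact (h3.trans h2).trans (le_max_left _ _)
        have hwj : ε / R' ≤ gridWidth α ε k j := by
          rw [gridWidth_of_lt hj, div_eq_mul_inv]
          gcongr
          refine le_trans ?_ (rpow_neg_bounds (by linarith) h.nonneg h.le_one).2.2
          exact inv_anti₀ (by linarith) hcR
        rw [gridCenter_apply, abs_div, abs_mul, abs_of_pos (hw j), abs_two,
          div_le_iff₀ two_pos] at hcA
        rw [le_div_iff₀ hε]
        rw [div_le_iff₀ hR'0] at hwj
        calc |(k j : ℝ)| * ε ≤ |(k j : ℝ)| * (gridWidth α ε k j * R') := by gcongr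
          _ = |(k j : ℝ)| * gridWidth α ε k j * R' := by ring
          _ ≤ max A 0 * 2 * R' := by gcongr
          _ = 2 * max A 0 * R' := by ring
      · refine le_trans ?_ (le_max_left _ _)
        rw [lastIdx_eq_iff.2 hj, le_div_iff₀ hε]
        rw [gridCenter_lastIdx] at h1 hcR
        rw [← abs_of_pos hε, ← abs_mul, abs_of_pos (by linarith)]
        linarith
    have hkN' : ∀ j, |k j| ≤ N := fun j => by exact_mod_cast hkN j
    exact ⟨fun j => (abs_le.1 (hkN' j)).1, fun j => (abs_le.1 (hkN' j)).2⟩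
  choose! k hk hkN using this
  refine Set.Finite.of_injOn (f := k) hkN ?_ (finite_Icc (fun _ : Fin m => -N) fun _ => N)
  intro κ hκ κ' hκ' hkk
  obtain ⟨hw, e⟩ := hk κ hκ
  obtain ⟨hw', e'⟩ := hk κ' hκ'
  rw [e, e']
  congr 1 <;> rw [hkk]

theorem isUniformFamily_gridCharts [T2Space M] (hε : 0 < ε) (hε2 : ε ≤ 1 / 2) (hKc : IsCompact K)
    (hK : K ⊆ φ.target) : IsUniformFamily g (gridCharts h hφ ε K) where
  tight κ hκ := (isTight_of_mem_funnelCharts h hφ hK (gridCharts_subset h hφ hκ)).1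
  normalized κ hκ := (isTight_of_mem_funnelCharts h hφ hK (gridCharts_subset h hφ hκ)).2.1
  multiplicity := ⟨4 ^ m, encard_gridCharts_le h hφ hε⟩
  transition k := by
    obtain ⟨c, hc⟩ := exists_bcNormLE_transition_funnelCharts h hφ hφ hKc hK hε hε2 hKc hK hε hε2 k
    exact ⟨c, fun κ hκ κ' hκ' =>
      hc κ (gridCharts_subset h hφ hκ) κ' (gridCharts_subset h hφ hκ')⟩
  equivalent := by
    obtain ⟨c, hc1, hc⟩ := exists_equivalent_pushforwardMetric_funnelCharts h hφ hKc hK hε hε2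
    exact ⟨c, hc1, fun κ hκ => hc κ (gridCharts_subset h hφ hκ)⟩
  bounded k := by
    obtain ⟨c, hc⟩ := exists_bcNormLE_pushforwardMetric_funnelCharts h hφ hKc hK hε hε2 k
    exact ⟨c, fun κ hκ => hc κ (gridCharts_subset h hφ hκ)⟩
  locallyFinite _ hL := finite_gridCharts_inter h hφ hε hKc hL

/-- The shrunken boxes of the grid cover the part of the end above height `T` and above the open
coordinate cube with center `v` and half side length `δ / 2` in the base. -/
theorem exists_mem_gridCharts {T δ : ℝ} (hε : 0 < ε) (hεT : ε ≤ (T - 1) / 2) (hεδ : ε ≤ δ / 4)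
    {v : EuclideanSpace ℝ (Fin d)} (hv : ∀ i : Fin d, m - 1 ≤ i.val → v i = 0)
    {t : ℝ} (ht : T < t) {y : EuclideanSpace ℝ (Fin d)} (hy : y ∈ φ.source)
    (hyv : ∀ i, |φ y i - v i| < δ / 2) {p : M} (hp : p ∈ V)
    (hpt : Φ p = WithLp.toLp 2 (t, t ^ α • y)) :
    ∃ κ ∈ gridCharts h hφ ε {x | ∀ i, |x i - v i| ≤ δ}, p ∈ κ.source ∧ κ p ∈ cube m (3 / 4) := by
  have ht0 : 0 < t := by linarith
  have hps : p ∈ (endChart h hφ).source := by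
    refine ⟨hp, ?_⟩
    rw [mem_preimage, hpt]
    refine ⟨ht0, ?_⟩
    change t ^ (-α) • t ^ α • y ∈ φ.source
    rwa [rpow_neg_smul_rpow_smul ht0]
  have hx : endChart h hφ p = fromBase m d h.base_le (φ y) + t • lastVec m := by
    change funnelInv h.base_le α φ (Φ p) = _
    rw [hpt, funnelInv_toLp _ ht0]
  set x := endChart h hφ p
  have hx0 : 0 ≤ x 0 := ((endChart h hφ).map_source hps).2
  have hxt : x (lastIdx m) = t := by rw [hx, fromBase_add_lastIdx]
  have hxv : ∀ (j : Fin m) (hj : j.val < m - 1),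
      |x j - v ⟨j.val, by have := h.base_le; omega⟩| < δ / 2 := fun j hj => by
    have : x j = φ y ⟨j.val, by have := h.base_le; omega⟩ := by
      rw [hx, PiLp.add_apply, PiLp.smul_apply, lastVec_of_lt hj, fromBase_apply, dif_pos hj]
      simp
    rw [this]
    exact hyv _
  obtain ⟨n, hn, hn0⟩ := exists_int_abs_sub_lt hε t
  -- `t` is at most `3 ε / 4` above the center, and `7 ε / 4 < T - 1`
  have hc1 : 1 < n * ε / 2 - ε := by linarith [(abs_lt.1 hn).2]
  set w := gridWidth α ε fun _ : Fin m => n with hw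
  have hwpos : ∀ j, 0 < w j := gridWidth_pos hε (by rw [gridCenter_lastIdx]; linarith)
  -- the last index has to be chosen first, as it determines the widths in the other directions
  have : ∀ j : Fin m, ∃ kj : ℤ, (j = lastIdx m → kj = n) ∧ |x j - kj * w j / 2| < 3 / 4 * w j ∧
      (0 ≤ x j → kj = 0 ∨ 2 ≤ kj) := fun j => by
    by_cases hj : j = lastIdx m
    · subst hj
      rw [hxt, hw, gridWidth_lastIdx]
      exact ⟨n, fun _ => rfl, hn, hn0⟩
    · obtain ⟨kj, h1, h2⟩ := exists_int_abs_sub_lt (hwpos j) (x j)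
      exact ⟨kj, fun e => absurd e hj, h1, h2⟩
  choose k hkn hk hk0 using this
  have hkl : k (lastIdx m) = n := hkn _ rfl
  have hkw : gridWidth α ε k = w := gridWidth_congr hkl
  have hkw' : ∀ i, 0 < gridWidth α ε k i := hkw ▸ hwpos
  have hkc : ∀ j, |x j - gridCenter α ε k j| < 3 / 4 * gridWidth α ε k j := fun j => by
    rw [gridCenter_apply, hkw]; exact hk j
  have hcl : gridCenter α ε k (lastIdx m) = n * ε / 2 := by rw [gridCenter_lastIdx, hkl]
  refine ⟨_, ⟨k, hkw', ⟨gridWidth_lastIdx, fun j hj => gridWidth_of_lt hj, by rwa [hcl], ?_⟩,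
    hk0 0 hx0, rfl⟩, mem_boxChart_source.2 ⟨hps, fun j => (hkc j).trans ?_⟩,
    boxChart_mem_cube.2 hkc⟩
  · intro x' hx' i
    rw [toBase_apply]
    split_ifs with hi
    · have hwε : gridWidth α ε k ⟨i.val, by omega⟩ ≤ ε := by
        rw [gridWidth_of_lt hi, hcl]
        exact mul_le_of_le_one_right hε.le
          (rpow_neg_bounds (by linarith) h.nonneg h.le_one).2.1
      have h1 := abs_le.1 (hx' ⟨i.val, by omega⟩)
      have h2 := abs_lt.1 (hkc ⟨i.val, by omega⟩)
      have h3 := abs_lt.1 (hxv ⟨i.val, by omega⟩ hi)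
      simp only [Fin.eta] at h3
      rw [abs_le]
      constructor <;> linarith [h1.1, h1.2, h2.1, h2.2, h3.1, h3.2]
    · rw [hv i (not_lt.1 hi)]
      simp only [sub_zero, abs_zero]
      linarith
  · linarith [hkw' j]

/-- The part of a tame end away from its base is covered by a uniform family of charts. -/
theorem IsTameEnd.exists_isUniformFamily [T2Space M] (h : IsTameEnd g V α B Φ) {T : ℝ}
    (hT : 1 < T) :
    ∃ 𝒦 : Set (PartialEquiv M (EuclideanSpace ℝ (Fin m))), IsUniformFamily g 𝒦 ∧
      (∀ κ ∈ 𝒦, κ.source ⊆ V) ∧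
      ∀ p ∈ V, T < (Φ p).fst → ∃ κ ∈ 𝒦, p ∈ κ.source ∧ κ p ∈ cube m (3 / 4) := by
  have key : ∀ b ∈ B, ∃ φ : OpenPartialHomeomorph (EuclideanSpace ℝ (Fin d))
      (EuclideanSpace ℝ (Fin d)), ∃ δ : ℝ, b ∈ φ.source ∧ IsBaseChart m B φ ∧ 0 < δ ∧
        {x : EuclideanSpace ℝ (Fin d) | ∀ i, |x i - φ b i| ≤ δ} ⊆ φ.target := fun b hb => by
    obtain ⟨φ, hbφ, h1, h2, h3⟩ := h.isSubmanifold_base.2 b hb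
    obtain ⟨r, hr, hball⟩ := Metric.isOpen_iff.1 φ.open_target _ (φ.map_source hbφ)
    have hs : 0 < √d + 1 := by positivity
    refine ⟨φ, r / (√d + 1), hbφ, ⟨h1, h2, h3⟩, by positivity, fun x hx => hball ?_⟩
    have h1 : √d * (r / (√d + 1)) < r := by
      rw [mul_div_assoc', div_lt_iff₀ hs]; nlinarith [Real.sqrt_nonneg d]
    have hr0 : 0 ≤ r / (√d + 1) := by positivity
    rw [Metric.mem_ball, EuclideanSpace.dist_eq]
    refine lt_of_le_of_lt ?_ h1
    rw [← Real.sqrt_sq hr0, ← Real.sqrt_mul (Nat.cast_nonneg d)]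
    apply Real.sqrt_le_sqrt
    calc ∑ i, dist (x i) (φ b i) ^ 2 ≤ ∑ _i : Fin d, (r / (√d + 1)) ^ 2 := by
          gcongr with i
          exact hx i
      _ = d * (r / (√d + 1)) ^ 2 := by simp
  choose φ δ hbφ hφ hδ hK using key
  obtain ⟨s, hs⟩ := h.isCompact_base.elim_nhds_subcover'
    (fun b hb => (φ b hb).source ∩ (φ b hb) ⁻¹' {x | ∀ i, |x i - φ b hb b i| < δ b hb / 2})
    fun b hb => by
      refine (φ b hb).isOpen_inter_preimage ?_ |>.mem_nhds
        ⟨hbφ b hb, fun i => by simpa using hδ b hb⟩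
      simp only [ofPred_forall]
      exact isOpen_iInter_of_finite fun i => isOpen_lt (by fun_prop) (by fun_prop)
  set ε : B → ℝ := fun b => min (1 / 2) (min ((T - 1) / 2) (δ b b.2 / 4)) with hεdef
  have hε : ∀ b, 0 < ε b := fun b => by
    have := hδ b b.2
    have : 0 < T - 1 := by linarith
    positivity
  have hε2 : ∀ b, ε b ≤ 1 / 2 := fun b => min_le_left _ _
  set K : B → Set (EuclideanSpace ℝ (Fin d)) :=
    fun b => {x | ∀ i, |x i - φ b b.2 b i| ≤ δ b b.2} with hKdef
  have hKc : ∀ b, IsCompact (K b) := fun b => by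
    refine Metric.isCompact_of_isClosed_isBounded ?_ ?_
    · simp only [hKdef, ofPred_forall]
      exact isClosed_iInter fun i => isClosed_le (by fun_prop) (by fun_prop)
    · refine (Metric.isBounded_closedBall (x := φ b b.2 b) (r := √d * δ b b.2)).subset
        fun x hx => ?_
      rw [Metric.mem_closedBall, EuclideanSpace.dist_eq, ← Real.sqrt_sq (hδ b b.2).le,
        ← Real.sqrt_mul (Nat.cast_nonneg d)]
      apply Real.sqrt_le_sqrt
      calc ∑ i, dist (x i) (φ b b.2 b i) ^ 2 ≤ ∑ _i : Fin d, (δ b b.2) ^ 2 := by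
            gcongr with i
            exact hx i
        _ = d * (δ b b.2) ^ 2 := by simp
  refine ⟨⋃ b : s, gridCharts h (hφ b b.1.2) (ε b) (K b), IsUniformFamily.iUnion (fun b =>
    isUniformFamily_gridCharts h _ (hε b) (hε2 b) (hKc b) (hK _ _)) ?_, ?_, ?_⟩
  · rintro b b' - k
    obtain ⟨c, hc⟩ := exists_bcNormLE_transition_funnelCharts h (hφ b b.1.2) (hφ b' b'.1.2)
      (hKc b) (hK _ _) (hε b) (hε2 b) (hKc b') (hK _ _) (hε b') (hε2 b') k
    exact ⟨c, fun κ hκ κ' hκ' =>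
      hc κ (gridCharts_subset _ _ hκ) κ' (gridCharts_subset _ _ hκ')⟩
  · intro κ hκ
    obtain ⟨b, hb⟩ := mem_iUnion.1 hκ
    exact (isTight_of_mem_funnelCharts h _ (hK b b.1.2) (gridCharts_subset _ _ hb)).2.2
  · intro p hp hpT
    obtain ⟨t, ht, y, hy, e⟩ := h.exists_apply_eq hp
    rw [e] at hpT
    obtain ⟨b, hbs, hyb⟩ := mem_iUnion₂.1 (hs hy)
    obtain ⟨κ, hκ, hκp⟩ := exists_mem_gridCharts h (hφ b b.2) (hε b)
      ((min_le_right _ _).trans (min_le_left _ _)) ((min_le_right _ _).trans (min_le_right _ _))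
      ((hφ b b.2).apply_mem (hbφ b b.2) b.2).1 hpT hyb.1 hyb.2 hp e
    exact ⟨κ, mem_iUnion.2 ⟨⟨b, hbs⟩, hκ⟩, hκp⟩

end Grid

/-! ### Assembling the atlas -/

section Assembly

variable {m : ℕ} [NeZero m] {M : Type*} [TopologicalSpace M]
  [ChartedSpace (EuclideanHalfSpace m) M] [IsManifold (𝓡∂ m) ∞ M] {g : Metric m M}

theorem IsUniformFamily.isUniformlyRegular
    {𝒦 : Set (PartialEquiv M (EuclideanSpace ℝ (Fin m)))} (h : IsUniformFamily g 𝒦) {r : ℝ}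
    (hr0 : 0 < r) (hr1 : r < 1) (hr : ∀ p : M, ∃ κ ∈ 𝒦, p ∈ κ.source ∧ κ p ∈ cube m r) :
    IsUniformlyRegular g :=
  ⟨𝒦, ⟨h.normalized, fun p => (hr p).imp fun _ hκ => ⟨hκ.1, hκ.2.1⟩, ⟨r, hr0, hr1, hr⟩,
    h.multiplicity, h.transition⟩, h.equivalent, h.bounded⟩

theorem exists_finite_tight_cover {L : Set M} (hL : IsCompact L) :
    ∃ 𝒦₀ : Set (PartialEquiv M (EuclideanSpace ℝ (Fin m))), 𝒦₀.Finite ∧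
      (∀ κ ∈ 𝒦₀, IsTight κ ∧ IsNormalizedChart κ) ∧
      ∀ p ∈ L, ∃ κ ∈ 𝒦₀, p ∈ κ.source ∧ κ p ∈ cube m (3 / 4) := by
  choose κ h1 h2 h3 h4 using exists_tight_normalized_chart (m := m) (M := M)
  obtain ⟨s, -, hs⟩ := hL.elim_nhds_subcover (fun p => (κ p).source ∩ κ p ⁻¹' cube m (3 / 4))
    fun p _ => ((h2 p).contMDiffOn.continuousOn.isOpen_inter_preimage (h2 p).isOpen_source
      (isOpen_cube _)).mem_nhds ⟨h3 p, by rw [mem_preimage, h4]; intro i; simp⟩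
  refine ⟨κ '' s, s.finite_toSet.image κ, ?_, fun p hp => ?_⟩
  · rintro _ ⟨p, -, rfl⟩
    exact ⟨h1 p, h2 p⟩
  · obtain ⟨q, hq, hpq⟩ := mem_iUnion₂.1 (hs hp)
    exact ⟨κ q, mem_image_of_mem κ hq, hpq⟩

/-- The uniform families of the ends are completed by finitely many charts that cover `V₀` and the
bases of the ends. -/
theorem HasTameEnds.isUniformlyRegular [T2Space M] (hg : HasTameEnds g) : IsUniformlyRegular g := by
  obtain ⟨k, V₀, V, -, hcov, hdisj, hV₀, -, hV⟩ := hg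
  choose d α B Φ hend T hT hTc using hV
  choose 𝒦 h𝒦 hsub hcover using fun i => (hend i).exists_isUniformFamily (hT i)
  have hends : IsUniformFamily g (⋃ i, 𝒦 i) := IsUniformFamily.iUnion h𝒦 fun i j hij n =>
    ⟨0, fun κ hκ κ' hκ' => bcNormLE_transition_of_disjoint
      ((hdisj i j hij).mono (hsub i κ hκ) (hsub j κ' hκ')) n 0⟩
  obtain ⟨𝒦₀, hfin, h𝒦₀, hcover₀⟩ := exists_finite_tight_cover (m := m)
    (hV₀.union (isCompact_iUnion hTc))
  refine (hends.union_of_finite hfin h𝒦₀).isUniformlyRegular (r := 3 / 4) (by norm_num)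
    (by norm_num) fun p => ?_
  by_cases hp : p ∈ closure V₀ ∪ ⋃ i, closure {p ∈ V i | (Φ i p).fst ≤ T i}
  · obtain ⟨κ, hκ, h⟩ := hcover₀ p hp
    exact ⟨κ, Or.inl hκ, h⟩
  · rw [mem_union, not_or, mem_iUnion, not_exists] at hp
    have hpV : p ∈ V₀ ∪ ⋃ i, V i := hcov ▸ mem_univ p
    obtain ⟨i, hi⟩ := mem_iUnion.1 (hpV.resolve_left fun h => hp.1 (subset_closure h))
    obtain ⟨κ, hκ, h⟩ := hcover i p hi
      (not_le.1 fun h => hp.2 i (subset_closure ⟨hi, h⟩))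
    exact ⟨κ, Or.inr (mem_iUnion.2 ⟨i, hκ⟩), h⟩

end Assembly

end TameEnds

end

theorem theorem1p2 (m : ℕ) [NeZero m] (M : Type*) [TopologicalSpace M] [T2Space M]
    [SecondCountableTopology M] [ChartedSpace (EuclideanHalfSpace m) M]
    [IsManifold (𝓡∂ m) ∞ M] (g : TameEnds.Metric m M) (hg : TameEnds.HasTameEnds g) :
    TameEnds.IsUniformlyRegular g :=
  hg.isUniformlyRegular
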